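/- Let $\mathcal H$ be a complex Hilbert space. Let $H_0$ be a self-adjoint operator in $\mathcal H$ with domain $\mathcal D$, bounded below, whose spectrum consists of a strictly increasing sequence of simple eigenvalues, $\sigma(H_0)=\{\lambda_0<\lambda_1<\dots<\lambda_l<\dots\}\subset\mathbb R$, with $$\delta:=\inf_{j\ge 0}\frac{\lambda_{j+1}-\lambda_j}{2}>0 .$$ Let $H_1$ be a bounded operator on $\mathcal H$, and let $J$ be a linear unitary involution of $\mathcal H$ that maps $\mathcal D$ to $\mathcal D$ and satisfies $JH_0=H_0^*J$ and $JH_1=H_1^*J$. For real $\varepsilon$ let $H_\varepsilon=H_0+\varepsilon H_1$ with domain $\mathcal D$, and let $Q_l=\{z\in\mathbb C: |\mathrm{Re}\,z-\lambda_l|<\delta,\ |\mathrm{Im}\,z|<\delta\}$ be the open square of side $2\delta$ centred at $\lambda_l$. Then, for all $\varepsilon\in\mathbb R$ with $|\varepsilon|\,\|H_1\|<\delta$ (that is, $|\varepsilon|<\delta/\|H_1\|$ if $H_1\ne0$): 1. The spectrum is real: $\sigma(H_\varepsilon)\subset\mathbb R$. 2. Every $z\notin\bigcup_l Q_l$ belongs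 to the resolvent set of $H_\varepsilon$. For such $z$ the series $$(H_\varepsilon-z)^{-1}=\sum_{k\ge0}(H_0-z)^{-1}\bigl[-\varepsilon H_1(H_0-z)^{-1}\bigr]^k$$ converges in operator norm, and $$\|(H_\varepsilon-z)^{-1}\|\le \frac{1}{\mathrm{dist}(z,\sigma(H_0))-|\varepsilon|\,\|H_1\|}.$$ 3. Each eigenvalue $\lambda_l$ of $H_0$ continues to exactly one real eigenvalue $\Lambda_l(\varepsilon)$ of $H_\varepsilon$: there are real-valued functions $\Lambda_l$, continuous on $\{\varepsilon\in\mathbb R:|\varepsilon|\,\|H_1\|<\delta\}$, with $\Lambda_l(0)=\lambda_l$, such that $\sigma(H_\varepsilon)=\{\Lambda_l(\varepsilon): l\ge 0\}$ and $\sigma(H_\varepsilon)\cap Q_l=\{\Lambda_l(\varepsilon)\}$ for every $l$. Moreover, $\ker(H_\varepsilon-\Lambda_l(\varepsilon))$ is one-dimensional and the operator $$P_l(\varepsilon)=-\frac1{2\pi i}\oint_{\partial Q_l}(H_\varepsilon-z)^{-1}\,dz$$ (with $\partial Q_l$ counterclockwise) is a projection, $P_l(\varepsilon)^2=P_l(\varepsilon)$,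 with range $\ker(H_\varepsilon-\Lambda_l(\varepsilon))$. -/

import Mathlib

open scoped InnerProductSpace

noncomputable section

namespace UnboundedOp

variable {H : Type*} [NormedAddCommGroup H] [InnerProductSpace ℂ H]

/-- `R` is a bounded two-sided inverse of `A - z : D(A) → H`. -/
def IsResolventAt (A : H →ₗ.[ℂ] H) (z : ℂ) (R : H →L[ℂ] H) : Prop :=
  (∀ y : H, ∃ h : R y ∈ A.domain, A ⟨R y, h⟩ - z • R y = y) ∧
    ∀ x : A.domain, R (A x - z • (x : H)) = x

/-- The resolvent set of a (possibly unbounded) operator `A`. -/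
def resolventSet (A : H →ₗ.[ℂ] H) : Set ℂ := {z | ∃ R : H →L[ℂ] H, IsResolventAt A z R}

/-- The spectrum of a (possibly unbounded) operator `A`. -/
def spectrum (A : H →ₗ.[ℂ] H) : Set ℂ := (resolventSet A)ᶜ

open scoped Classical in
/-- The resolvent `(A - z)⁻¹`, set to `0` when `z` is in the spectrum. -/
def resolvent (A : H →ₗ.[ℂ] H) (z : ℂ) : H →L[ℂ] H :=
  if h : ∃ R : H →L[ℂ] H, IsResolventAt A z R then h.choose else 0

/-- A bounded inverse of `A - z` is unique, so `resolvent A z` is that inverse. -/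
theorem IsResolventAt.resolvent_eq {A : H →ₗ.[ℂ] H} {z : ℂ} {R : H →L[ℂ] H}
    (hR : IsResolventAt A z R) : resolvent A z = R := by
  have hex : ∃ R : H →L[ℂ] H, IsResolventAt A z R := ⟨R, hR⟩
  have hs : IsResolventAt A z (resolvent A z) := by
    simp only [resolvent, dif_pos hex]
    exact hex.choose_spec
  ext y
  obtain ⟨h, hy⟩ := hs.1 y
  have h2 := hR.2 ⟨_, h⟩
  rw [hy] at h2
  exact h2.symm

/-- The geometric eigenspace `ker (A - μ) ⊆ D(A)`, as a subspace of `H`. -/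
def eigenspace (A : H →ₗ.[ℂ] H) (μ : ℂ) : Submodule ℂ H :=
  (LinearMap.ker (A.toFun - μ • A.domain.subtype)).map A.domain.subtype

/-- The operator `A + ε B` with domain `D(A)`, for `B` bounded. -/
def perturb (A : H →ₗ.[ℂ] H) (B : H →L[ℂ] H) (ε : ℂ) : H →ₗ.[ℂ] H where
  domain := A.domain
  toFun := A.toFun + ε • (B.toLinearMap ∘ₗ A.domain.subtype)

/-- `J A = A* J` on `D(A)`, for `J` mapping `D(A)` into `D(A*)`. -/
def IntertwinesAdjoint [CompleteSpace H] (J : H →L[ℂ] H) (A : H →ₗ.[ℂ] H) : Prop :=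
  ∀ x : A.domain, ∃ h : J x ∈ A.adjoint.domain, J (A x) = A.adjoint ⟨J x, h⟩

/-- The open square of side `2 r`, with sides parallel to the axes, centred at the real
point `a`. -/
def openSquare (a r : ℝ) : Set ℂ := {z | |z.re - a| < r ∧ |z.im| < r}

/-- The counterclockwise integral of `f` over the boundary of `openSquare a r`. -/
def squareIntegral {E : Type*} [NormedAddCommGroup E] [NormedSpace ℂ E]
    (f : ℂ → E) (a r : ℝ) : E :=
  (∫ x in (a - r)..(a + r), f ((x : ℂ) - (r : ℂ) * Complex.I))
    + Complex.I • (∫ y in (-r)..r, f (((a + r : ℝ) : ℂ) + (y : ℂ) * Complex.I))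
    - (∫ x in (a - r)..(a + r), f ((x : ℂ) + (r : ℂ) * Complex.I))
    - Complex.I • (∫ y in (-r)..r, f (((a - r : ℝ) : ℂ) + (y : ℂ) * Complex.I))

/-- The Riesz projection `-(2πi)⁻¹ ∮ (A - z)⁻¹ dz` over the boundary of `openSquare a r`,
counterclockwise. The sign is that of the resolvent convention `(A - z)⁻¹`. -/
def rieszProjection (A : H →ₗ.[ℂ] H) (a r : ℝ) : H →L[ℂ] H :=
  (-(2 * (Real.pi : ℂ) * Complex.I)⁻¹) • squareIntegral (resolvent A) a r

end UnboundedOp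

end

/-! For self-adjoint `H₀` the resolvent at `z` is a normal bounded operator, so its norm is its
spectral radius, which is at most `1 / dist(z, σ(H₀))` (`norm_resolvent_le_of_isSelfAdjoint`). If
`|ε| ‖H₁‖` is below this distance, the Neumann series inverts `H_ε - z`
(`norm_resolvent_perturb_le`). Off the squares the distance is at least `δ`; in a closed square it
is at least the sup-norm distance to the centre (`supDist_le_norm_sub_of_gap`), so a collar inside
the boundary also consists of resolvent points.

Hence the Riesz projection over each square is defined for every admissible `ε`. It is idempotent
(`rieszProjection_mul_self`) and norm continuous in `ε`, so its rank is constant on the interval of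
admissible `ε` (`finrank_range_eq_of_continuousOn`). At `ε = 0` the inverse-distance bound excludes
generalized eigenvectors, the range is the eigenspace (`range_rieszProjection_eq_eigenspace`), and
the rank is one.

A rank one Riesz projection leaves exactly one spectral point in the square, a simple eigenvalue
(`exists_eigenvalue_of_finrank_rieszProjection`). The involution `J` enters only to make the
spectrum of `H_ε` symmetric under conjugation (`conj_mem_resolventSet_perturb`). The square is
symmetric too, so its only spectral point is its own conjugate and is real. Continuity follows by
writing the eigenvalue as a quotient of continuous matrix elements (`continuousOn_eigenvalue`). -/

namespace UnboundedOp

/-! ### Resolvent identities and Neumann series -/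

section ResolventAlgebra

variable {H : Type*} [NormedAddCommGroup H] [InnerProductSpace ℂ H]

theorem isResolventAt_resolvent {A : H →ₗ.[ℂ] H} {z : ℂ} (hz : z ∈ resolventSet A) :
    IsResolventAt A z (resolvent A z) := by
  obtain ⟨R, hR⟩ := hz
  rwa [hR.resolvent_eq]

theorem IsResolventAt.mem_resolventSet {A : H →ₗ.[ℂ] H} {z : ℂ} {R : H →L[ℂ] H}
    (hR : IsResolventAt A z R) : z ∈ resolventSet A := ⟨R, hR⟩

theorem IsResolventAt.apply_injective {A : H →ₗ.[ℂ] H} {z : ℂ} {R : H →L[ℂ] H}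
    (hR : IsResolventAt A z R) {y : H} (hy : R y = 0) : y = 0 := by
  obtain ⟨h, e⟩ := hR.1 y
  have : A ⟨R y, h⟩ = 0 := by
    rw [show (⟨R y, h⟩ : A.domain) = 0 from Subtype.ext hy, LinearPMap.map_zero]
  rw [this, hy] at e
  simpa using e.symm

/-- The first resolvent identity. -/
theorem IsResolventAt.sub_eq {A : H →ₗ.[ℂ] H} {z w : ℂ} {R S : H →L[ℂ] H}
    (hR : IsResolventAt A z R) (hS : IsResolventAt A w S) : R - S = (z - w) • (R * S) := by
  ext y
  obtain ⟨h, e⟩ := hS.1 y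
  have h1 := hR.2 ⟨S y, h⟩
  have e' : A ⟨S y, h⟩ = y + w • S y := by linear_combination (norm := module) e
  simp only [e', map_sub, map_add, map_smul] at h1
  change R y - S y = (z - w) • R (S y)
  linear_combination (norm := module) h1

theorem IsResolventAt.commute {A : H →ₗ.[ℂ] H} {z w : ℂ} {R S : H →L[ℂ] H}
    (hR : IsResolventAt A z R) (hS : IsResolventAt A w S) : R * S = S * R := by
  rcases eq_or_ne z w with rfl | h
  · rw [← hR.resolvent_eq, ← hS.resolvent_eq]
  · have h1 := hR.sub_eq hS
    have h2 := hS.sub_eq hR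
    have h3 : (z - w) • (R * S) = (z - w) • (S * R) := by
      linear_combination (norm := module) -h1 - h2
    exact smul_right_injective _ (sub_ne_zero.2 h) h3

/-- An operator commuting with the resolvent at `w` and satisfying the resolvent identity with
it is the resolvent at `z`. -/
theorem IsResolventAt.of_resolvent_identity {A : H →ₗ.[ℂ] H} {z w : ℂ} {R X : H →L[ℂ] H}
    (hR : IsResolventAt A w R) (h1 : X = R * (1 + (z - w) • X)) (h2 : X = (1 + (z - w) • X) * R) :
    IsResolventAt A z X := by
  constructor
  · intro y
    obtain ⟨h, e⟩ := hR.1 (y + (z - w) • X y)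
    have hX : X y = R (y + (z - w) • X y) := by
      conv_lhs => rw [h1]
      simp
    have hd : X y ∈ A.domain := by rw [hX]; exact h
    refine ⟨hd, ?_⟩
    have e2 : A ⟨X y, hd⟩ = A ⟨R (y + (z - w) • X y), h⟩ := congrArg A (Subtype.ext hX)
    rw [e2]
    have e3 := congrArg (w • ·) hX
    linear_combination (norm := module) e - e3
  · intro x
    have hx := hR.2 x
    set u := A x - w • (x : H) with hu
    have h3 : X u = R u + (z - w) • X (R u) := by
      conv_lhs => rw [h2]
      simp
    have h4 : A x - z • (x : H) = u - (z - w) • (x : H) := by rw [hu]; module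
    rw [h4, map_sub, map_smul, h3, hx]
    module

theorem perturb_zero (A : H →ₗ.[ℂ] H) (B : H →L[ℂ] H) : perturb A B 0 = A := by
  refine LinearPMap.ext rfl ?_
  intro x hx hx'
  change A ⟨x, hx⟩ + (0 : ℂ) • B x = _
  simp

/-- The second resolvent identity as a construction: `R (1 + ε B R)⁻¹` is the resolvent of
`A + ε B`. -/
theorem IsResolventAt.perturb {A : H →ₗ.[ℂ] H} {B : H →L[ℂ] H} {ε z : ℂ} {R C : H →L[ℂ] H}
    (hR : IsResolventAt A z R) (h1 : (1 + ε • (B * R)) * C = 1) (h2 : C * (1 + ε • (B * R)) = 1) :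
    IsResolventAt (perturb A B ε) z (R * C) := by
  constructor
  · intro y
    obtain ⟨h, e⟩ := hR.1 (C y)
    refine ⟨h, ?_⟩
    have h3 : C y + ε • B (R (C y)) = y := congrArg (fun T : H →L[ℂ] H => T y) h1
    change A ⟨R (C y), h⟩ + ε • B (R (C y)) - z • R (C y) = y
    linear_combination (norm := module) e + h3
  · intro x
    have hx := hR.2 x
    set u := A x - z • (x : H) with hu
    have h3 : C (u + ε • B (R u)) = u := congrArg (fun T : H →L[ℂ] H => T u) h2
    rw [hx] at h3
    change R (C (A x + ε • B (x : H) - z • (x : H))) = x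
    rw [show A x + ε • B (x : H) - z • (x : H) = u + ε • B (x : H) by rw [hu]; abel, h3, hx]

/-- Moving the spectral parameter is a perturbation by the identity, so the Neumann series in `ε`
also yields analyticity in `z`. -/
theorem isResolventAt_perturb_one_iff {A : H →ₗ.[ℂ] H} {c z : ℂ} {R : H →L[ℂ] H} :
    IsResolventAt (UnboundedOp.perturb A 1 c) z R ↔ IsResolventAt A (z - c) R := by
  have key : ∀ x : A.domain, A x + c • (x : H) - z • (x : H) = A x - (z - c) • (x : H) := by
    intro x; module
  constructor
  · rintro ⟨h1, h2⟩
    refine ⟨fun y => ?_, fun x => ?_⟩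
    · obtain ⟨h, e⟩ := h1 y
      exact ⟨h, (key ⟨R y, h⟩).symm.trans e⟩
    · rw [← key]; exact h2 x
  · rintro ⟨h1, h2⟩
    refine ⟨fun y => ?_, fun x => ?_⟩
    · obtain ⟨h, e⟩ := h1 y
      exact ⟨h, (key ⟨R y, h⟩).trans e⟩
    · exact (congrArg R (key x)).trans (h2 x)

/-- The second resolvent identity. -/
theorem IsResolventAt.perturb_sub_eq {A : H →ₗ.[ℂ] H} {B : H →L[ℂ] H} {ε ε' z : ℂ}
    {R S : H →L[ℂ] H} (hR : IsResolventAt (UnboundedOp.perturb A B ε) z R)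
    (hS : IsResolventAt (UnboundedOp.perturb A B ε') z S) :
    R - S = (ε' - ε) • (R * B * S) := by
  ext y
  obtain ⟨h, e⟩ := hS.1 y
  have h1 := hR.2 ⟨S y, h⟩
  have e' : A ⟨S y, h⟩ = y + z • S y - ε' • B (S y) := by
    have e2 : A ⟨S y, h⟩ + ε' • B (S y) - z • S y = y := e
    linear_combination (norm := module) e2
  have h2 : R (A ⟨S y, h⟩ + ε • B (S y) - z • S y) = S y := h1
  rw [e'] at h2
  simp only [map_sub, map_add, map_smul] at h2
  change R y - S y = (ε' - ε) • R (B (S y))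
  linear_combination (norm := module) h2

variable [CompleteSpace H]

theorem IsResolventAt.perturb_inverse {A : H →ₗ.[ℂ] H} {B : H →L[ℂ] H} {ε z : ℂ} {R : H →L[ℂ] H}
    (hR : IsResolventAt A z R) (h : ‖ε • (B * R)‖ < 1) :
    IsResolventAt (UnboundedOp.perturb A B ε) z (R * Ring.inverse (1 - -(ε • (B * R)))) := by
  have hu : IsUnit (1 - -(ε • (B * R))) := (Units.oneSub _ (by rwa [norm_neg])).isUnit
  refine hR.perturb ?_ ?_
  · simpa only [sub_neg_eq_add] using Ring.mul_inverse_cancel _ hu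
  · simpa only [sub_neg_eq_add] using Ring.inverse_mul_cancel _ hu

/-- The Neumann series of the perturbed resolvent. -/
theorem IsResolventAt.hasSum_perturb {A : H →ₗ.[ℂ] H} {B : H →L[ℂ] H} {ε z : ℂ} {R : H →L[ℂ] H}
    (hR : IsResolventAt A z R) (h : ‖ε • (B * R)‖ < 1) :
    HasSum (fun k : ℕ => R * (-(ε • (B * R))) ^ k)
      (resolvent (UnboundedOp.perturb A B ε) z) := by
  rw [(hR.perturb_inverse h).resolvent_eq]
  exact (hasSum_geom_series_inverse _ (by rwa [norm_neg])).mul_left R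

theorem exists_nhds_resolvent_eq {A : H →ₗ.[ℂ] H} {w : ℂ} {R : H →L[ℂ] H}
    (hR : IsResolventAt A w R) :
    ∀ᶠ z in nhds w, IsResolventAt A z (R * Ring.inverse (1 - (z - w) • R)) := by
  have hc : Filter.Tendsto (fun z : ℂ => ‖(w - z) • (1 * R)‖) (nhds w) (nhds 0) := by
    have : Continuous fun z : ℂ => ‖(w - z) • (1 * R)‖ := by fun_prop
    simpa using this.tendsto w
  filter_upwards [hc.eventually_lt_const one_pos] with z hz
  have h := hR.perturb_inverse hz
  rw [isResolventAt_perturb_one_iff] at h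
  have e : (1 : H →L[ℂ] H) - -((w - z) • (1 * R)) = 1 - (z - w) • R := by
    rw [one_mul]; module
  rwa [e, sub_sub_cancel] at h

/-- Near `w` the resolvent is an explicit expression in the Banach algebra inverse, which is
differentiable at units. -/
theorem differentiableAt_resolvent {A : H →ₗ.[ℂ] H} {w : ℂ} (hw : w ∈ resolventSet A) :
    DifferentiableAt ℂ (resolvent A) w := by
  have hR := isResolventAt_resolvent hw
  set R := resolvent A w
  have h : DifferentiableAt ℂ (fun z : ℂ => R * Ring.inverse (1 - (z - w) • R)) w := by
    refine (differentiableAt_const _).mul ?_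
    have h1 : DifferentiableAt ℂ (fun z : ℂ => 1 - (z - w) • R) w := by fun_prop
    refine DifferentiableAt.comp (g := Ring.inverse) w ?_ h1
    exact differentiableAt_inverse (by simp)
  refine h.congr_of_eventuallyEq ?_
  filter_upwards [exists_nhds_resolvent_eq hR] with z hz using hz.resolvent_eq

theorem norm_resolvent_perturb_le {A : H →ₗ.[ℂ] H} {B : H →L[ℂ] H} {ε z : ℂ} {d : ℝ}
    (hz : z ∈ resolventSet A) (hd : ‖ε‖ * ‖B‖ < d) (hR : ‖resolvent A z‖ ≤ 1 / d) :
    ‖ε • (B * resolvent A z)‖ < 1 ∧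
    z ∈ resolventSet (UnboundedOp.perturb A B ε) ∧
    ‖resolvent (UnboundedOp.perturb A B ε) z‖ ≤ 1 / (d - ‖ε‖ * ‖B‖) := by
  have hd0 : 0 < d := lt_of_le_of_lt (by positivity) hd
  have h0 := isResolventAt_resolvent hz
  set R := resolvent A z
  have h1 : ‖ε • (B * R)‖ < 1 := by
    calc ‖ε • (B * R)‖ ≤ ‖ε‖ * (‖B‖ * ‖R‖) := by
          rw [norm_smul]; gcongr; exact norm_mul_le _ _
      _ ≤ ‖ε‖ * ‖B‖ * (1 / d) := by rw [← mul_assoc]; gcongr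
      _ < d * (1 / d) := by gcongr
      _ = 1 := by field_simp
  have hS := h0.perturb_inverse h1
  refine ⟨h1, hS.mem_resolventSet, ?_⟩
  have hS' := isResolventAt_resolvent hS.mem_resolventSet
  set S := resolvent (UnboundedOp.perturb A B ε) z
  -- The relation `S = R - ε S B R` bounds `‖S‖` by itself with a factor below one, which is then
  -- absorbed on the left.
  have e := hS'.perturb_sub_eq (S := R) (ε' := 0) (by rwa [perturb_zero])
  have h2 : ‖S‖ ≤ 1 / d + ‖S‖ * (‖ε‖ * ‖B‖) * (1 / d) := by
    calc ‖S‖ = ‖R + (0 - ε) • (S * B * R)‖ := by rw [← e]; congr 1; abel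
      _ ≤ ‖R‖ + ‖ε‖ * (‖S‖ * ‖B‖ * ‖R‖) := by
          refine (norm_add_le _ _).trans ?_
          rw [norm_smul, zero_sub, norm_neg]
          gcongr
          exact (norm_mul_le _ _).trans (by gcongr; exact norm_mul_le _ _)
      _ ≤ 1 / d + ‖ε‖ * (‖S‖ * ‖B‖ * (1 / d)) := by gcongr
      _ = _ := by ring
  rw [le_div_iff₀ (by linarith)]
  field_simp at h2
  linarith

end ResolventAlgebra

end UnboundedOp

namespace UnboundedOp

/-! ### Self-adjoint operators: adjoint resolvents, conjugation symmetry, norm bound -/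

section SelfAdjoint

variable {H : Type*} [NormedAddCommGroup H] [InnerProductSpace ℂ H] [CompleteSpace H]

theorem inner_symm_of_isSelfAdjoint {A : H →ₗ.[ℂ] H} (hA : IsSelfAdjoint A) (x y : A.domain) :
    ⟪A x, (y : H)⟫_ℂ = ⟪(x : H), A y⟫_ℂ := by
  have h := LinearPMap.adjoint_isFormalAdjoint hA.dense_domain
  rw [LinearPMap.isSelfAdjoint_def.1 hA] at h
  exact h x y

/-- The hypothesis says that `y` lies in the domain of `A*` with `A* y = w`, and `A* = A`. -/
theorem apply_eq_of_forall_inner {A : H →ₗ.[ℂ] H} (hA : IsSelfAdjoint A) {y w : H}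
    (h : ∀ x : A.domain, ⟪w, (x : H)⟫_ℂ = ⟪y, A x⟫_ℂ) : ∃ hy : y ∈ A.domain, A ⟨y, hy⟩ = w := by
  have hy := LinearPMap.mem_adjoint_domain_of_exists y ⟨w, h⟩
  have e := LinearPMap.adjoint_apply_eq hA.dense_domain ⟨y, hy⟩ h
  -- The membership proof depends on the operator, so `A* = A` is substituted through a variable `T`
  -- instead of rewritten.
  have hs : ∀ T : H →ₗ.[ℂ] H, T = A → ∀ hy : y ∈ T.domain, T ⟨y, hy⟩ = w →
      ∃ hy : y ∈ A.domain, A ⟨y, hy⟩ = w := by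
    rintro T rfl hy e
    exact ⟨hy, e⟩
  exact hs _ (LinearPMap.isSelfAdjoint_def.1 hA) hy e

theorem IntertwinesAdjoint.map_apply {A : H →ₗ.[ℂ] H} (hA : IsSelfAdjoint A) {J : H →L[ℂ] H}
    (hJ : IntertwinesAdjoint J A) (x : A.domain) :
    ∃ h : J x ∈ A.domain, A ⟨J x, h⟩ = J (A x) := by
  obtain ⟨h, e⟩ := hJ x
  have hs : ∀ T : H →ₗ.[ℂ] H, T = A → ∀ h : J x ∈ T.domain, J (A x) = T ⟨J x, h⟩ →
      ∃ h : J x ∈ A.domain, A ⟨J x, h⟩ = J (A x) := by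
    rintro T rfl h e
    exact ⟨h, e.symm⟩
  exact hs _ (LinearPMap.isSelfAdjoint_def.1 hA) h e

/-- The adjoint of the resolvent of `A + ε B` at `z` is the resolvent of `A + ε̄ B*` at `z̄`. -/
theorem IsResolventAt.adjoint_perturb {A : H →ₗ.[ℂ] H} (hA : IsSelfAdjoint A) {B : H →L[ℂ] H}
    {ε z : ℂ} {R : H →L[ℂ] H} (hR : IsResolventAt (UnboundedOp.perturb A B ε) z R) :
    IsResolventAt (UnboundedOp.perturb A (ContinuousLinearMap.adjoint B) (starRingEnd ℂ ε))
      (starRingEnd ℂ z) (ContinuousLinearMap.adjoint R) := by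
  constructor
  · intro y
    set v := ContinuousLinearMap.adjoint R y with hv
    obtain ⟨hd, e⟩ := apply_eq_of_forall_inner hA (y := v)
      (w := y + starRingEnd ℂ z • v - starRingEnd ℂ ε • ContinuousLinearMap.adjoint B v) (by
        intro x
        have h : R (A x + ε • B (x : H) - z • (x : H)) = x := hR.2 x
        have h1 : ⟪v, A x + ε • B (x : H) - z • (x : H)⟫_ℂ = ⟪y, (x : H)⟫_ℂ := by
          rw [hv, ContinuousLinearMap.adjoint_inner_left, h]
        simp only [inner_sub_right, inner_add_right, inner_smul_right] at h1
        simp only [inner_sub_left, inner_add_left, inner_smul_left, Complex.conj_conj,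
          ContinuousLinearMap.adjoint_inner_left]
        linear_combination -h1)
    refine ⟨hd, ?_⟩
    change A ⟨v, hd⟩ + starRingEnd ℂ ε • ContinuousLinearMap.adjoint B v - starRingEnd ℂ z • v = y
    rw [e]
    abel
  · intro x
    change ContinuousLinearMap.adjoint R (A x + starRingEnd ℂ ε • ContinuousLinearMap.adjoint B x
      - starRingEnd ℂ z • (x : H)) = x
    refine ext_inner_left ℂ fun u => ?_
    obtain ⟨h, e⟩ := hR.1 u
    have e' : A ⟨R u, h⟩ + ε • B (R u) - z • R u = u := e
    rw [ContinuousLinearMap.adjoint_inner_right]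
    have hs := inner_symm_of_isSelfAdjoint hA ⟨R u, h⟩ x
    conv_rhs => rw [← e']
    simp only [inner_sub_right, inner_add_right, inner_smul_right, inner_sub_left, inner_add_left,
      inner_smul_left, ContinuousLinearMap.adjoint_inner_right] at hs ⊢
    rw [hs]

theorem IsResolventAt.adjoint {A : H →ₗ.[ℂ] H} (hA : IsSelfAdjoint A) {z : ℂ} {R : H →L[ℂ] H}
    (hR : IsResolventAt A z R) :
    IsResolventAt A (starRingEnd ℂ z) (ContinuousLinearMap.adjoint R) := by
  have h := IsResolventAt.adjoint_perturb hA (B := 0) (ε := 0) (z := z) (R := R)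
    (by rwa [perturb_zero])
  rwa [map_zero (starRingEnd ℂ), perturb_zero] at h

/-- The spectrum of a perturbation commuting with an involution up to adjoints is symmetric with
respect to the real axis. -/
theorem conj_mem_resolventSet_perturb {A : H →ₗ.[ℂ] H} (hA : IsSelfAdjoint A)
    {B J : H →L[ℂ] H} (hJ : J * J = 1) (hJA : IntertwinesAdjoint J A)
    (hJB : J * B = ContinuousLinearMap.adjoint B * J) {ε : ℝ} {z : ℂ}
    (hz : z ∈ resolventSet (perturb A B ε)) :
    starRingEnd ℂ z ∈ resolventSet (perturb A B ε) := by
  obtain ⟨R, hR⟩ := hz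
  have hJJ : ∀ x, J (J x) = x := fun x => congrArg (fun T : H →L[ℂ] H => T x) hJ
  have hJB' : ∀ x, J (B x) = ContinuousLinearMap.adjoint B (J x) :=
    fun x => congrArg (fun T : H →L[ℂ] H => T x) hJB
  have hBJ : ∀ x, J (ContinuousLinearMap.adjoint B x) = B (J x) := fun x => by
    rw [← hJJ (B (J x)), hJB', hJJ]
  have hS := IsResolventAt.adjoint_perturb hA hR
  rw [Complex.conj_ofReal] at hS
  set S := ContinuousLinearMap.adjoint R
  -- `S = R*` inverts `A + ε B* - z̄`, and conjugation by `J` turns `B*` back into `B` while fixing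
  -- `A`.
  refine ⟨J * S * J, fun y => ?_, fun x => ?_⟩
  · obtain ⟨h, e⟩ := hS.1 (J y)
    have e' : A ⟨S (J y), h⟩ + (ε : ℂ) • ContinuousLinearMap.adjoint B (S (J y))
      - starRingEnd ℂ z • S (J y) = J y := e
    obtain ⟨hd, ed⟩ := hJA.map_apply hA ⟨S (J y), h⟩
    refine ⟨hd, ?_⟩
    change A ⟨J (S (J y)), hd⟩ + (ε : ℂ) • B (J (S (J y))) - starRingEnd ℂ z • J (S (J y)) = y
    have e2 := congrArg J e'
    simp only [map_sub, map_add, map_smul, hBJ, hJJ] at e2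
    rwa [ed]
  · obtain ⟨hd, ed⟩ := hJA.map_apply hA x
    have h := hS.2 ⟨J x, hd⟩
    have h' : S (A ⟨J x, hd⟩ + (ε : ℂ) • ContinuousLinearMap.adjoint B (J x)
      - starRingEnd ℂ z • J (x : H)) = J x := h
    change J (S (J (A x + (ε : ℂ) • B x - starRingEnd ℂ z • (x : H)))) = x
    have e2 := congrArg J h'
    rw [hJJ, ed] at e2
    rwa [map_sub, map_add, map_smul, map_smul, hJB']

/-- With `S` the resolvent at `z + μ⁻¹`, the inverse of `μ - R` is `μ⁻¹ (1 + μ⁻¹ S)`, by the first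
resolvent identity. -/
theorem notMem_spectrum_resolvent {A : H →ₗ.[ℂ] H} {z μ : ℂ} {R : H →L[ℂ] H}
    (hR : IsResolventAt A z R) (hμ : μ ≠ 0) (h : z + μ⁻¹ ∈ resolventSet A) :
    μ ∉ _root_.spectrum ℂ R := by
  rw [_root_.spectrum.notMem_iff]
  obtain ⟨S, hS⟩ := h
  have e1 := hR.sub_eq hS
  have e2 := hS.commute hR
  rw [sub_add_cancel_left] at e1
  have hS' : S * R = R * S := e2
  have h1 : (μ • (1 : H →L[ℂ] H) - R) * (1 + μ⁻¹ • S) = μ • 1 := by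
    simp only [sub_mul, mul_smul_comm, mul_add, mul_one, smul_mul_assoc, one_mul,
      smul_sub, smul_smul, inv_mul_cancel₀ hμ, one_smul]
    linear_combination (norm := module) -e1
  have h2 : (1 + μ⁻¹ • S) * (μ • (1 : H →L[ℂ] H) - R) = μ • 1 := by
    simp only [mul_sub, mul_smul_comm, add_mul, mul_one, smul_mul_assoc, one_mul, smul_add,
      smul_smul, mul_inv_cancel₀ hμ, one_smul, hS']
    linear_combination (norm := module) -e1
  rw [Algebra.algebraMap_eq_smul_one]
  refine ⟨⟨μ • 1 - R, μ⁻¹ • (1 + μ⁻¹ • S), ?_, ?_⟩, rfl⟩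
  · rw [mul_smul_comm, h1, smul_smul, inv_mul_cancel₀ hμ, one_smul]
  · rw [smul_mul_assoc, h2, smul_smul, inv_mul_cancel₀ hμ, one_smul]

/-- The resolvent of a self-adjoint operator is bounded by the inverse distance to the
spectrum. -/
theorem norm_resolvent_le_of_isSelfAdjoint {A : H →ₗ.[ℂ] H} (hA : IsSelfAdjoint A) {z : ℂ}
    (hz : z ∈ resolventSet A) {d : ℝ} (hd : 0 < d) (h : ∀ w ∈ spectrum A, d ≤ ‖w - z‖) :
    ‖resolvent A z‖ ≤ 1 / d := by
  have hR := isResolventAt_resolvent hz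
  set R := resolvent A z
  -- `R*` is the resolvent at `z̄`, and resolvents commute.
  have hn : IsStarNormal R := ⟨(hR.adjoint hA).commute hR⟩
  have hs := IsStarNormal.spectralRadius_eq_nnnorm R
  have hle : spectralRadius ℂ R ≤ ENNReal.ofReal (1 / d) := by
    refine iSup₂_le fun μ hμ => ?_
    rw [← enorm_eq_nnnorm, ← ofReal_norm]
    refine ENNReal.ofReal_le_ofReal ?_
    -- Zero may belong to the spectrum of `R` without coming from a point of the spectrum of `A`.
    rcases eq_or_ne μ 0 with rfl | h0
    · rw [norm_zero]; positivity
    have hm : z + μ⁻¹ ∈ spectrum A := fun hm => notMem_spectrum_resolvent hR h0 hm hμ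
    have := h _ hm
    rw [add_sub_cancel_left, norm_inv] at this
    rw [le_div_iff₀ hd]
    have h0' : 0 < ‖μ‖ := norm_pos_iff.2 h0
    calc ‖μ‖ * d ≤ ‖μ‖ * ‖μ‖⁻¹ := by gcongr
      _ = 1 := mul_inv_cancel₀ h0'.ne'
  rw [hs, ← enorm_eq_nnnorm, ← ofReal_norm] at hle
  exact (ENNReal.ofReal_le_ofReal_iff (by positivity)).1 hle

end SelfAdjoint

end UnboundedOp

namespace UnboundedOp

/-! ### Contour integrals over squares -/

section SquareIntegral

open MeasureTheory

variable {E : Type*} [NormedAddCommGroup E]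

/-- The distance to the real point `a` in the supremum norm of `ℂ = ℝ²`. -/
def supDist (a : ℝ) (z : ℂ) : ℝ := max |z.re - a| |z.im|

theorem mem_openSquare_iff {a r : ℝ} {z : ℂ} : z ∈ openSquare a r ↔ supDist a z < r :=
  max_lt_iff.symm

theorem supDist_le_norm_sub (a : ℝ) (z : ℂ) : supDist a z ≤ ‖z - a‖ := by
  refine max_le ?_ ?_
  · simpa using Complex.abs_re_le_norm (z - a)
  · simpa using Complex.abs_im_le_norm (z - a)

theorem norm_sub_le_two_mul_supDist (a : ℝ) (z : ℂ) : ‖z - a‖ ≤ 2 * supDist a z := by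
  have h := Complex.norm_le_abs_re_add_abs_im (z - a)
  simp only [Complex.sub_re, Complex.ofReal_re, Complex.sub_im, Complex.ofReal_im, sub_zero] at h
  have h1 : |z.re - a| ≤ supDist a z := le_max_left _ _
  have h2 : |z.im| ≤ supDist a z := le_max_right _ _
  linarith

theorem supDist_bottom {a r x : ℝ} (hr : 0 ≤ r) (hx : x ∈ Set.uIcc (a - r) (a + r)) :
    supDist a (x - r * Complex.I) = r := by
  rw [Set.uIcc_of_le (by linarith)] at hx
  have : |x - a| ≤ r := abs_le.2 ⟨by linarith [hx.1], by linarith [hx.2]⟩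
  simp [supDist, abs_of_nonneg hr, this]

theorem supDist_top {a r x : ℝ} (hr : 0 ≤ r) (hx : x ∈ Set.uIcc (a - r) (a + r)) :
    supDist a (x + r * Complex.I) = r := by
  rw [Set.uIcc_of_le (by linarith)] at hx
  have : |x - a| ≤ r := abs_le.2 ⟨by linarith [hx.1], by linarith [hx.2]⟩
  simp [supDist, abs_of_nonneg hr, this]

theorem supDist_right {a r y : ℝ} (hr : 0 ≤ r) (hy : y ∈ Set.uIcc (-r) r) :
    supDist a (((a + r : ℝ) : ℂ) + y * Complex.I) = r := by
  rw [Set.uIcc_of_le (by linarith)] at hy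
  simp [supDist, abs_of_nonneg hr, abs_le.2 hy]

theorem supDist_left {a r y : ℝ} (hr : 0 ≤ r) (hy : y ∈ Set.uIcc (-r) r) :
    supDist a (((a - r : ℝ) : ℂ) + y * Complex.I) = r := by
  rw [Set.uIcc_of_le (by linarith)] at hy
  simp [supDist, abs_of_nonneg hr, abs_le.2 hy]

theorem intervalIntegrable_horizontal {f : ℂ → E} {y x₁ x₂ : ℝ} (hx : x₁ ≤ x₂)
    (hf : ∀ z : ℂ, z.re ∈ Set.Icc x₁ x₂ → z.im = y → ContinuousAt f z) :
    IntervalIntegrable (fun x : ℝ => f (x + y * Complex.I)) volume x₁ x₂ := by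
  refine ContinuousOn.intervalIntegrable fun x hx' => ?_
  rw [Set.uIcc_of_le hx] at hx'
  refine ContinuousAt.continuousWithinAt ?_
  refine ContinuousAt.comp (g := f) (hf _ (by simpa using hx') (by simp)) ?_
  fun_prop

theorem intervalIntegrable_vertical {f : ℂ → E} {x y₁ y₂ : ℝ} (hy : y₁ ≤ y₂)
    (hf : ∀ z : ℂ, z.re = x → z.im ∈ Set.Icc y₁ y₂ → ContinuousAt f z) :
    IntervalIntegrable (fun y : ℝ => f (x + y * Complex.I)) volume y₁ y₂ := by
  refine ContinuousOn.intervalIntegrable fun y hy' => ?_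
  rw [Set.uIcc_of_le hy] at hy'
  refine ContinuousAt.continuousWithinAt ?_
  refine ContinuousAt.comp (g := f) (hf _ (by simp) (by simpa using hy')) ?_
  fun_prop

theorem intervalIntegrable_edges {f : ℂ → E} {a r : ℝ} (hr : 0 ≤ r)
    (hf : ∀ z, supDist a z = r → ContinuousAt f z) :
    IntervalIntegrable (fun x : ℝ => f (x - r * Complex.I)) volume (a - r) (a + r) ∧
    IntervalIntegrable (fun y : ℝ => f (((a + r : ℝ) : ℂ) + y * Complex.I)) volume (-r) r ∧
    IntervalIntegrable (fun x : ℝ => f (x + r * Complex.I)) volume (a - r) (a + r) ∧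
    IntervalIntegrable (fun y : ℝ => f (((a - r : ℝ) : ℂ) + y * Complex.I)) volume (-r) r := by
  refine ⟨?_, ?_, ?_, ?_⟩ <;>
    refine ContinuousOn.intervalIntegrable fun x hx => ContinuousAt.continuousWithinAt ?_
  · exact ContinuousAt.comp (g := f) (hf _ (supDist_bottom hr hx)) (by fun_prop)
  · exact ContinuousAt.comp (g := f) (hf _ (supDist_right hr hx)) (by fun_prop)
  · exact ContinuousAt.comp (g := f) (hf _ (supDist_top hr hx)) (by fun_prop)
  · exact ContinuousAt.comp (g := f) (hf _ (supDist_left hr hx)) (by fun_prop)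

variable [NormedSpace ℂ E]

/-- The integral of `f` over a horizontal segment. -/
noncomputable def horizontalIntegral (f : ℂ → E) (y x₁ x₂ : ℝ) : E := ∫ x in x₁..x₂, f (x + y * Complex.I)

/-- The integral of `f` over a vertical segment, with respect to arc length. -/
noncomputable def verticalIntegral (f : ℂ → E) (x y₁ y₂ : ℝ) : E := ∫ y in y₁..y₂, f (x + y * Complex.I)

/-- The counterclockwise integral of `f` over the boundary of `[x₁, x₂] × [y₁, y₂]`. -/
noncomputable def rectIntegral (f : ℂ → E) (x₁ x₂ y₁ y₂ : ℝ) : E :=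
  horizontalIntegral f y₁ x₁ x₂ + Complex.I • verticalIntegral f x₂ y₁ y₂
    - horizontalIntegral f y₂ x₁ x₂ - Complex.I • verticalIntegral f x₁ y₁ y₂

theorem squareIntegral_eq_rectIntegral (f : ℂ → E) (a r : ℝ) :
    squareIntegral f a r = rectIntegral f (a - r) (a + r) (-r) r := by
  simp only [squareIntegral, rectIntegral, horizontalIntegral, verticalIntegral,
    Complex.ofReal_neg, neg_mul, ← sub_eq_add_neg]

theorem rectIntegral_eq_zero {f : ℂ → E} {x₁ x₂ y₁ y₂ : ℝ} (hx : x₁ ≤ x₂) (hy : y₁ ≤ y₂)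
    (hf : ∀ z : ℂ, z.re ∈ Set.Icc x₁ x₂ → z.im ∈ Set.Icc y₁ y₂ → DifferentiableAt ℂ f z) :
    rectIntegral f x₁ x₂ y₁ y₂ = 0 := by
  have h := Complex.integral_boundary_rect_eq_zero_of_differentiableOn f ⟨x₁, y₁⟩ ⟨x₂, y₂⟩
    (fun z hz => by
      rw [Complex.mem_reProdIm] at hz
      simp only [Set.uIcc_of_le hx, Set.uIcc_of_le hy] at hz
      exact (hf z hz.1 hz.2).differentiableWithinAt)
  rw [rectIntegral, ← h]
  simp only [horizontalIntegral, verticalIntegral]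
  abel

theorem horizontalIntegral_add_adjacent {f : ℂ → E} {y x₁ x₂ x₃ : ℝ} (h₁ : x₁ ≤ x₂) (h₂ : x₂ ≤ x₃)
    (hf : ∀ z : ℂ, z.re ∈ Set.Icc x₁ x₃ → z.im = y → ContinuousAt f z) :
    horizontalIntegral f y x₁ x₃ = horizontalIntegral f y x₁ x₂ + horizontalIntegral f y x₂ x₃ :=
  (intervalIntegral.integral_add_adjacent_intervals
    (intervalIntegrable_horizontal h₁ fun z hz => hf z ⟨hz.1, hz.2.trans h₂⟩)
    (intervalIntegrable_horizontal h₂ fun z hz => hf z ⟨h₁.trans hz.1, hz.2⟩)).symm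

theorem verticalIntegral_add_adjacent {f : ℂ → E} {x y₁ y₂ y₃ : ℝ} (h₁ : y₁ ≤ y₂) (h₂ : y₂ ≤ y₃)
    (hf : ∀ z : ℂ, z.re = x → z.im ∈ Set.Icc y₁ y₃ → ContinuousAt f z) :
    verticalIntegral f x y₁ y₃ = verticalIntegral f x y₁ y₂ + verticalIntegral f x y₂ y₃ :=
  (intervalIntegral.integral_add_adjacent_intervals
    (intervalIntegrable_vertical h₁ fun z hz hz' => hf z hz ⟨hz'.1, hz'.2.trans h₂⟩)
    (intervalIntegrable_vertical h₂ fun z hz hz' => hf z hz ⟨h₁.trans hz'.1, hz'.2⟩)).symm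

/-- A function holomorphic on a closed square annulus has the same integral over both
boundary components. -/
theorem squareIntegral_eq_of_differentiableAt {f : ℂ → E} {a r s : ℝ} (hr : 0 ≤ r) (hrs : r ≤ s)
    (hf : ∀ z, r ≤ supDist a z → supDist a z ≤ s → DifferentiableAt ℂ f z) :
    squareIntegral f a r = squareIntegral f a s := by
  have hin : ∀ z : ℂ, a - s ≤ z.re → z.re ≤ a + s → -s ≤ z.im → z.im ≤ s → supDist a z ≤ s :=
    fun z h1 h2 h3 h4 => max_le (abs_le.2 ⟨by linarith, by linarith⟩) (abs_le.2 ⟨h3, h4⟩)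
  have hL : ∀ z : ℂ, z.re ≤ a - r → r ≤ supDist a z := fun z h =>
    le_max_of_le_left (le_abs.2 (Or.inr (by linarith)))
  have hR : ∀ z : ℂ, a + r ≤ z.re → r ≤ supDist a z := fun z h =>
    le_max_of_le_left (le_abs.2 (Or.inl (by linarith)))
  have hB : ∀ z : ℂ, z.im ≤ -r → r ≤ supDist a z := fun z h =>
    le_max_of_le_right (le_abs.2 (Or.inr (by linarith)))
  have hT : ∀ z : ℂ, r ≤ z.im → r ≤ supDist a z := fun z h =>
    le_max_of_le_right (le_abs.2 (Or.inl (by linarith)))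
  -- The annulus is cut into two full-height side rectangles and two rectangles above and below the
  -- inner square. Cauchy's theorem applies to each, and the shared edges cancel in the sum.
  have e1 : rectIntegral f (a - s) (a - r) (-s) s = 0 :=
    rectIntegral_eq_zero (by linarith) (by linarith) fun z ⟨h1, h2⟩ ⟨h3, h4⟩ =>
      hf z (hL z h2) (hin z (by linarith) (by linarith) (by linarith) (by linarith))
  have e2 : rectIntegral f (a + r) (a + s) (-s) s = 0 :=
    rectIntegral_eq_zero (by linarith) (by linarith) fun z ⟨h1, h2⟩ ⟨h3, h4⟩ =>
      hf z (hR z h1) (hin z (by linarith) (by linarith) (by linarith) (by linarith))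
  have e3 : rectIntegral f (a - r) (a + r) (-s) (-r) = 0 :=
    rectIntegral_eq_zero (by linarith) (by linarith) fun z ⟨h1, h2⟩ ⟨h3, h4⟩ =>
      hf z (hB z h4) (hin z (by linarith) (by linarith) (by linarith) (by linarith))
  have e4 : rectIntegral f (a - r) (a + r) r s = 0 :=
    rectIntegral_eq_zero (by linarith) (by linarith) fun z ⟨h1, h2⟩ ⟨h3, h4⟩ =>
      hf z (hT z h3) (hin z (by linarith) (by linarith) (by linarith) (by linarith))
  have cB : ∀ z : ℂ, z.re ∈ Set.Icc (a - s) (a + s) → z.im = -s → ContinuousAt f z :=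
    fun z ⟨h1, h2⟩ h3 => (hf z (hB z (by linarith))
      (hin z (by linarith) (by linarith) (by linarith) (by linarith))).continuousAt
  have cT : ∀ z : ℂ, z.re ∈ Set.Icc (a - s) (a + s) → z.im = s → ContinuousAt f z :=
    fun z ⟨h1, h2⟩ h3 => (hf z (hT z (by linarith))
      (hin z (by linarith) (by linarith) (by linarith) (by linarith))).continuousAt
  have cL : ∀ z : ℂ, z.re = a - r → z.im ∈ Set.Icc (-s) s → ContinuousAt f z :=
    fun z h3 ⟨h1, h2⟩ => (hf z (hL z (by linarith))
      (hin z (by linarith) (by linarith) (by linarith) (by linarith))).continuousAt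
  have cR : ∀ z : ℂ, z.re = a + r → z.im ∈ Set.Icc (-s) s → ContinuousAt f z :=
    fun z h3 ⟨h1, h2⟩ => (hf z (hR z (by linarith))
      (hin z (by linarith) (by linarith) (by linarith) (by linarith))).continuousAt
  have sB := (horizontalIntegral_add_adjacent (x₂ := a - r) (by linarith) (by linarith) cB)
  have sB' := (horizontalIntegral_add_adjacent (x₁ := a - r) (x₂ := a + r) (x₃ := a + s)
    (by linarith) (by linarith) fun z hz => cB z ⟨by linarith [hz.1], hz.2⟩)
  have sT := (horizontalIntegral_add_adjacent (x₂ := a - r) (by linarith) (by linarith) cT)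
  have sT' := (horizontalIntegral_add_adjacent (x₁ := a - r) (x₂ := a + r) (x₃ := a + s)
    (by linarith) (by linarith) fun z hz => cT z ⟨by linarith [hz.1], hz.2⟩)
  have sL := (verticalIntegral_add_adjacent (y₂ := -r) (by linarith) (by linarith) cL)
  have sL' := (verticalIntegral_add_adjacent (y₁ := -r) (y₂ := r) (y₃ := s)
    (by linarith) (by linarith) fun z h hz => cL z h ⟨by linarith [hz.1], hz.2⟩)
  have sR := (verticalIntegral_add_adjacent (y₂ := -r) (by linarith) (by linarith) cR)
  have sR' := (verticalIntegral_add_adjacent (y₁ := -r) (y₂ := r) (y₃ := s)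
    (by linarith) (by linarith) fun z h hz => cR z h ⟨by linarith [hz.1], hz.2⟩)
  rw [squareIntegral_eq_rectIntegral, squareIntegral_eq_rectIntegral]
  simp only [rectIntegral] at *
  rw [sB, sB', sT, sT']
  rw [sL, sL'] at e1
  rw [sR, sR'] at e2
  linear_combination (norm := module) -e1 - e2 - e3 - e4

theorem squareIntegral_eq_zero {f : ℂ → E} {a r : ℝ} (hr : 0 ≤ r)
    (hf : ∀ z, supDist a z ≤ r → DifferentiableAt ℂ f z) : squareIntegral f a r = 0 := by
  rw [squareIntegral_eq_rectIntegral]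
  refine rectIntegral_eq_zero (by linarith) (by linarith) fun z h1 h2 => hf z ?_
  exact max_le (abs_le.2 ⟨by linarith [h1.1], by linarith [h1.2]⟩) (abs_le.2 h2)

theorem squareIntegral_congr {f g : ℂ → E} {a r : ℝ} (hr : 0 ≤ r)
    (h : ∀ z, supDist a z = r → f z = g z) : squareIntegral f a r = squareIntegral g a r := by
  unfold squareIntegral
  congr 1
  · congr 1
    · congr 1
      · exact intervalIntegral.integral_congr fun x hx => h _ (supDist_bottom hr hx)
      · congr 1
        exact intervalIntegral.integral_congr fun x hx => h _ (supDist_right hr hx)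
    · exact intervalIntegral.integral_congr fun x hx => h _ (supDist_top hr hx)
  · congr 1
    exact intervalIntegral.integral_congr fun x hx => h _ (supDist_left hr hx)

theorem squareIntegral_add {f g : ℂ → E} {a r : ℝ} (hr : 0 ≤ r)
    (hf : ∀ z, supDist a z = r → ContinuousAt f z)
    (hg : ∀ z, supDist a z = r → ContinuousAt g z) :
    squareIntegral (fun z => f z + g z) a r = squareIntegral f a r + squareIntegral g a r := by
  obtain ⟨f1, f2, f3, f4⟩ := intervalIntegrable_edges hr hf
  obtain ⟨g1, g2, g3, g4⟩ := intervalIntegrable_edges hr hg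
  simp only [squareIntegral]
  rw [intervalIntegral.integral_add f1 g1, intervalIntegral.integral_add f2 g2,
    intervalIntegral.integral_add f3 g3, intervalIntegral.integral_add f4 g4]
  module

theorem squareIntegral_sub {f g : ℂ → E} {a r : ℝ} (hr : 0 ≤ r)
    (hf : ∀ z, supDist a z = r → ContinuousAt f z)
    (hg : ∀ z, supDist a z = r → ContinuousAt g z) :
    squareIntegral (fun z => f z - g z) a r = squareIntegral f a r - squareIntegral g a r := by
  obtain ⟨f1, f2, f3, f4⟩ := intervalIntegrable_edges hr hf
  obtain ⟨g1, g2, g3, g4⟩ := intervalIntegrable_edges hr hg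
  simp only [squareIntegral]
  rw [intervalIntegral.integral_sub f1 g1, intervalIntegral.integral_sub f2 g2,
    intervalIntegral.integral_sub f3 g3, intervalIntegral.integral_sub f4 g4]
  module

theorem squareIntegral_clm_apply {F : Type*} [NormedAddCommGroup F] [NormedSpace ℂ F]
    [CompleteSpace E] [CompleteSpace F] (L : E →L[ℂ] F) {f : ℂ → E} {a r : ℝ} (hr : 0 ≤ r)
    (hf : ∀ z, supDist a z = r → ContinuousAt f z) :
    squareIntegral (fun z => L (f z)) a r = L (squareIntegral f a r) := by
  obtain ⟨f1, f2, f3, f4⟩ := intervalIntegrable_edges hr hf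
  simp only [squareIntegral, map_sub, map_add, map_smul]
  rw [L.intervalIntegral_comp_comm f1, L.intervalIntegral_comp_comm f2,
    L.intervalIntegral_comp_comm f3, L.intervalIntegral_comp_comm f4]

/-- The factor `8 * r` is the perimeter. -/
theorem norm_squareIntegral_le {f : ℂ → E} {a r C : ℝ} (hr : 0 ≤ r)
    (hf : ∀ z, supDist a z = r → ‖f z‖ ≤ C) : ‖squareIntegral f a r‖ ≤ 8 * r * C := by
  have e1 : |a + r - (a - r)| = 2 * r := by rw [abs_of_nonneg] <;> linarith
  have e2 : |r - -r| = 2 * r := by rw [abs_of_nonneg] <;> linarith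
  have h1 := intervalIntegral.norm_integral_le_of_norm_le_const (a := a - r) (b := a + r)
    (f := fun x : ℝ => f (x - r * Complex.I))
    fun x hx => hf _ (supDist_bottom hr (Set.uIoc_subset_uIcc hx))
  have h2 := intervalIntegral.norm_integral_le_of_norm_le_const (a := -r) (b := r)
    (f := fun y : ℝ => f (((a + r : ℝ) : ℂ) + y * Complex.I))
    fun x hx => hf _ (supDist_right hr (Set.uIoc_subset_uIcc hx))
  have h3 := intervalIntegral.norm_integral_le_of_norm_le_const (a := a - r) (b := a + r)
    (f := fun x : ℝ => f (x + r * Complex.I))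
    fun x hx => hf _ (supDist_top hr (Set.uIoc_subset_uIcc hx))
  have h4 := intervalIntegral.norm_integral_le_of_norm_le_const (a := -r) (b := r)
    (f := fun y : ℝ => f (((a - r : ℝ) : ℂ) + y * Complex.I))
    fun x hx => hf _ (supDist_left hr (Set.uIoc_subset_uIcc hx))
  rw [e1] at h1 h3
  rw [e2] at h2 h4
  unfold squareIntegral
  refine (norm_sub_le _ _).trans ((add_le_add_left (norm_sub_le _ _) _).trans
    ((add_le_add_left (add_le_add_left (norm_add_le _ _) _) _).trans ?_))
  rw [norm_smul, norm_smul, Complex.norm_I, one_mul, one_mul]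
  linarith

/-! ### The winding integral and Cauchy transforms -/

theorem log_neg_of_im_pos {z : ℂ} (hz : 0 < z.im) :
    Complex.log (-z) = Complex.log z - Real.pi * Complex.I := by
  simp only [Complex.log, norm_neg, Complex.arg_neg_eq_arg_sub_pi_of_im_pos hz, Complex.ofReal_sub]
  ring

theorem log_neg_of_im_neg {z : ℂ} (hz : z.im < 0) :
    Complex.log (-z) = Complex.log z + Real.pi * Complex.I := by
  simp only [Complex.log, norm_neg, Complex.arg_neg_eq_arg_add_pi_of_im_neg hz, Complex.ofReal_add]
  ring

theorem horizontalIntegral_inv_sub {w : ℂ} {y x₁ x₂ : ℝ} (hy : y ≠ w.im) :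
    horizontalIntegral (fun z => (z - w)⁻¹) y x₁ x₂ =
      Complex.log (x₂ + y * Complex.I - w) - Complex.log (x₁ + y * Complex.I - w) := by
  have hs : ∀ x : ℝ, (x + y * Complex.I - w : ℂ) ∈ Complex.slitPlane := fun x => by
    rw [Complex.mem_slitPlane_iff]
    right
    simpa [sub_eq_zero] using hy
  refine intervalIntegral.integral_eq_sub_of_hasDerivAt
    (f := fun x : ℝ => Complex.log (x + y * Complex.I - w)) (fun x _ => ?_) ?_
  · have h : HasDerivAt (fun x : ℝ => (x + y * Complex.I - w : ℂ)) 1 x :=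
      ((Complex.ofRealCLM.hasDerivAt (x := x)).add_const _).sub_const _
    simpa using h.clog_real (hs x)
  · refine Continuous.intervalIntegrable ?_ _ _
    exact Continuous.inv₀ (by fun_prop) fun x => Complex.slitPlane_ne_zero (hs x)

/-- The constant `σ` moves the edge off the branch cut without changing the logarithmic derivative.
It is `1` on the right edge and `-1` on the left one. -/
theorem I_smul_verticalIntegral_inv_sub {w : ℂ} {x y₁ y₂ : ℝ} {σ : ℂ} (hσ : σ ≠ 0)
    (hs : ∀ y : ℝ, σ * (x + y * Complex.I - w : ℂ) ∈ Complex.slitPlane) :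
    Complex.I • verticalIntegral (fun z => (z - w)⁻¹) x y₁ y₂ =
      Complex.log (σ * (x + y₂ * Complex.I - w)) - Complex.log (σ * (x + y₁ * Complex.I - w)) := by
  have h0 : ∀ y : ℝ, (x + y * Complex.I - w : ℂ) ≠ 0 := fun y h => by
    have := Complex.slitPlane_ne_zero (hs y)
    rw [h, mul_zero] at this
    exact this rfl
  rw [verticalIntegral, ← intervalIntegral.integral_smul]
  refine intervalIntegral.integral_eq_sub_of_hasDerivAt
    (f := fun y : ℝ => Complex.log (σ * (x + y * Complex.I - w))) (fun y _ => ?_) ?_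
  · have h : HasDerivAt (fun y : ℝ => σ * (x + y * Complex.I - w : ℂ)) (σ * (1 * Complex.I)) y :=
      ((((Complex.ofRealCLM.hasDerivAt (x := y)).mul_const _).const_add _).sub_const _).const_mul _
    have h' := h.clog_real (hs y)
    rwa [one_mul, mul_div_mul_left _ _ hσ, div_eq_mul_inv] at h'
  · refine Continuous.intervalIntegrable ?_ _ _
    exact (Continuous.inv₀ (by fun_prop) h0).const_mul Complex.I

/-- The principal logarithm is a primitive on all edges but the left one. There `log (-z)` replaces
it, and the two corrections by `π i` at its corners add up to `2 π i`. -/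
theorem rectIntegral_inv_sub {w : ℂ} {x₁ x₂ y₁ y₂ : ℝ} (h₁ : x₁ < w.re) (h₂ : w.re < x₂)
    (h₃ : y₁ < w.im) (h₄ : w.im < y₂) :
    rectIntegral (fun z => (z - w)⁻¹) x₁ x₂ y₁ y₂ = 2 * Real.pi * Complex.I := by
  have hR := I_smul_verticalIntegral_inv_sub (w := w) (x := x₂) (y₁ := y₁) (y₂ := y₂) one_ne_zero
    fun y => Complex.mem_slitPlane_iff.2 (Or.inl (by simpa using h₂))
  have hL := I_smul_verticalIntegral_inv_sub (w := w) (x := x₁) (y₁ := y₁) (y₂ := y₂)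
    (neg_ne_zero.2 one_ne_zero) fun y => Complex.mem_slitPlane_iff.2 (Or.inl (by simpa using h₁))
  rw [neg_one_mul, neg_one_mul, log_neg_of_im_pos (by simpa using h₄),
    log_neg_of_im_neg (by simpa using h₃)] at hL
  rw [one_mul, one_mul] at hR
  rw [rectIntegral, hR, hL, horizontalIntegral_inv_sub h₃.ne, horizontalIntegral_inv_sub h₄.ne']
  ring

theorem squareIntegral_inv_sub {w : ℂ} {a r : ℝ} (hw : supDist a w < r) :
    squareIntegral (fun z => (z - w)⁻¹) a r = 2 * Real.pi * Complex.I := by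
  obtain ⟨h1, h2⟩ := max_lt_iff.1 hw
  rw [abs_lt] at h1 h2
  rw [squareIntegral_eq_rectIntegral]
  exact rectIntegral_inv_sub (by linarith) (by linarith) h2.1 h2.2

/-- Differentiation under the integral: `w` has a positive distance to the compact curve, so the
differentiated kernel is uniformly bounded for parameters near `w`. -/
theorem differentiableAt_integral_inv_smul {γ : ℝ → ℂ} {g : ℝ → E} {a b : ℝ} {w : ℂ}
    (hγ : Continuous γ) (hg : ContinuousOn g (Set.uIcc a b)) (hw : ∀ t ∈ Set.uIcc a b, γ t ≠ w) :
    DifferentiableAt ℂ (fun z => ∫ t in a..b, (γ t - z)⁻¹ • g t) w := by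
  have hK : IsCompact (γ '' Set.uIcc a b) := isCompact_uIcc.image hγ
  obtain ⟨ρ, hρ, hball⟩ := Metric.isOpen_iff.1 hK.isClosed.isOpen_compl w (by
    rintro ⟨t, ht, e⟩
    exact hw t ht e)
  have hdist : ∀ z ∈ Metric.ball w (ρ / 2), ∀ t ∈ Set.uIcc a b, ρ / 2 ≤ ‖γ t - z‖ := by
    intro z hz t ht
    by_contra! h
    refine hball (a := γ t) ?_ ⟨t, ht, rfl⟩
    have h3 := dist_triangle (γ t) z w
    rw [Metric.mem_ball] at hz ⊢
    rw [← dist_eq_norm] at h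
    linarith
  have hne : ∀ z ∈ Metric.ball w (ρ / 2), ∀ t ∈ Set.uIcc a b, γ t - z ≠ 0 := by
    intro z hz t ht h
    have := hdist z hz t ht
    rw [h, norm_zero] at this
    linarith
  obtain ⟨M, hM⟩ := isCompact_uIcc.exists_bound_of_continuousOn hg
  have hM0 : 0 ≤ M := (norm_nonneg _).trans (hM a Set.left_mem_uIcc)
  have hnhds : Metric.ball w (ρ / 2) ∈ nhds w := Metric.ball_mem_nhds w (by positivity)
  have hcont : ∀ z ∈ Metric.ball w (ρ / 2),
      ContinuousOn (fun t => (γ t - z)⁻¹ • g t) (Set.uIcc a b) := fun z hz =>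
    ((hγ.continuousOn.sub continuousOn_const).inv₀ (hne z hz)).smul hg
  have hwm : w ∈ Metric.ball w (ρ / 2) := mem_of_mem_nhds hnhds
  have hcont' : ContinuousOn (fun t => ((γ t - w) ^ 2)⁻¹ • g t) (Set.uIcc a b) :=
    (((hγ.continuousOn.sub continuousOn_const).pow 2).inv₀
      fun t ht => pow_ne_zero 2 (hne w hwm t ht)).smul hg
  refine (intervalIntegral.hasDerivAt_integral_of_dominated_loc_of_deriv_le
    (F' := fun z t => ((γ t - z) ^ 2)⁻¹ • g t) (bound := fun _ => ((ρ / 2) ^ 2)⁻¹ * M)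
    hnhds ?_ (hcont w hwm).intervalIntegrable ?_ ?_ intervalIntegrable_const ?_).2.differentiableAt
  · filter_upwards [hnhds] with z hz
    exact ((hcont z hz).mono Set.uIoc_subset_uIcc).aestronglyMeasurable measurableSet_uIoc
  · exact (hcont'.mono Set.uIoc_subset_uIcc).aestronglyMeasurable measurableSet_uIoc
  · refine Filter.Eventually.of_forall fun t ht z hz => ?_
    have ht' := Set.uIoc_subset_uIcc ht
    rw [norm_smul, norm_inv, norm_pow]
    gcongr
    · exact hdist z hz t ht'
    · exact hM t ht'
  · refine Filter.Eventually.of_forall fun t ht z hz => ?_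
    have h0 := hne z hz t (Set.uIoc_subset_uIcc ht)
    have h : HasDerivAt (fun z => γ t - z) (-1) z := (hasDerivAt_id z).const_sub _
    have h' := (h.inv h0).smul_const (g t)
    simpa using h'

/-- The Cauchy transform of a function on the boundary of a square is holomorphic inside. -/
theorem differentiableAt_squareIntegral_inv_smul {f : ℂ → E} {a r : ℝ} {w : ℂ} (hr : 0 ≤ r)
    (hf : ∀ z, supDist a z = r → ContinuousAt f z) (hw : supDist a w < r) :
    DifferentiableAt ℂ (fun z => squareIntegral (fun u => (u - z)⁻¹ • f u) a r) w := by
  have hne : ∀ z, supDist a z = r → z ≠ w := by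
    rintro z h rfl
    exact hw.ne h
  have key : ∀ (γ : ℝ → ℂ) (x y : ℝ), Continuous γ → (∀ t ∈ Set.uIcc x y, supDist a (γ t) = r) →
      DifferentiableAt ℂ (fun z => ∫ t in x..y, (γ t - z)⁻¹ • f (γ t)) w := by
    intro γ x y hγ h
    refine differentiableAt_integral_inv_smul hγ (fun t ht => ?_) fun t ht => hne _ (h t ht)
    exact (ContinuousAt.comp (hf _ (h t ht)) hγ.continuousAt).continuousWithinAt
  exact (((key (fun x => x - r * Complex.I) _ _ (by fun_prop) fun t ht => supDist_bottom hr ht).add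
    ((key (fun y => ((a + r : ℝ) : ℂ) + y * Complex.I) _ _ (by fun_prop)
      fun t ht => supDist_right hr ht).const_smul Complex.I)).sub
    (key (fun x => x + r * Complex.I) _ _ (by fun_prop) fun t ht => supDist_top hr ht)).sub
    ((key (fun y => ((a - r : ℝ) : ℂ) + y * Complex.I) _ _ (by fun_prop)
      fun t ht => supDist_left hr ht).const_smul Complex.I)

end SquareIntegral

end UnboundedOp

namespace UnboundedOp

/-! ### Riesz projections and isolated eigenvalues -/

section Riesz

variable {H : Type*} [NormedAddCommGroup H] [InnerProductSpace ℂ H]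

theorem mem_eigenspace_iff {A : H →ₗ.[ℂ] H} {μ : ℂ} {x : H} :
    x ∈ eigenspace A μ ↔ ∃ h : x ∈ A.domain, A ⟨x, h⟩ = μ • x := by
  rw [eigenspace, Submodule.mem_map]
  constructor
  · rintro ⟨y, hy, rfl⟩
    refine ⟨y.2, ?_⟩
    rw [LinearMap.mem_ker] at hy
    exact sub_eq_zero.1 hy
  · rintro ⟨h, e⟩
    exact ⟨⟨x, h⟩, LinearMap.mem_ker.2 (sub_eq_zero.2 e), rfl⟩

/-- The form without division includes `w = μ`, where it forces `x = 0`; this is how eigenvalues are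
seen to be spectral points. -/
theorem IsResolventAt.smul_apply_eigenvector {A : H →ₗ.[ℂ] H} {w μ : ℂ} {R : H →L[ℂ] H} {x : H}
    (hR : IsResolventAt A w R) (hx : x ∈ eigenspace A μ) : (μ - w) • R x = x := by
  obtain ⟨h, e⟩ := mem_eigenspace_iff.1 hx
  have h1 := hR.2 ⟨x, h⟩
  rwa [e, ← sub_smul, map_smul] at h1

theorem IsResolventAt.mem_eigenspace {A : H →ₗ.[ℂ] H} {w μ : ℂ} {R : H →L[ℂ] H} {x : H}
    (hR : IsResolventAt A w R) (hx : (μ - w) • R x = x) : x ∈ eigenspace A μ := by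
  obtain ⟨h, e⟩ := hR.1 ((μ - w) • x)
  have hx' : R ((μ - w) • x) = x := by rw [map_smul, hx]
  have hd : x ∈ A.domain := by rw [← hx']; exact h
  refine mem_eigenspace_iff.2 ⟨hd, ?_⟩
  have e2 : A ⟨x, hd⟩ = A ⟨R ((μ - w) • x), h⟩ := congrArg A (Subtype.ext hx'.symm)
  rw [e2, sub_eq_iff_eq_add.1 e, hx']
  module

theorem eigenvalue_mem_spectrum {A : H →ₗ.[ℂ] H} {μ : ℂ} {x : H} (hx : x ∈ eigenspace A μ)
    (h0 : x ≠ 0) : μ ∈ spectrum A := by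
  rintro ⟨R, hR⟩
  have := hR.smul_apply_eigenvector hx
  rw [sub_self, zero_smul] at this
  exact h0 this.symm

variable [CompleteSpace H]

theorem squareIntegral_const_mul {f : ℂ → H →L[ℂ] H} {a r : ℝ} (hr : 0 ≤ r) (S : H →L[ℂ] H)
    (hf : ∀ z, supDist a z = r → ContinuousAt f z) :
    squareIntegral (fun z => S * f z) a r = S * squareIntegral f a r :=
  squareIntegral_clm_apply (ContinuousLinearMap.mul ℂ (H →L[ℂ] H) S) hr hf

theorem squareIntegral_mul_const {f : ℂ → H →L[ℂ] H} {a r : ℝ} (hr : 0 ≤ r) (S : H →L[ℂ] H)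
    (hf : ∀ z, supDist a z = r → ContinuousAt f z) :
    squareIntegral (fun z => f z * S) a r = squareIntegral f a r * S :=
  squareIntegral_clm_apply ((ContinuousLinearMap.mul ℂ (H →L[ℂ] H)).flip S) hr hf

theorem squareIntegral_const_smul {f : ℂ → H →L[ℂ] H} {a r : ℝ} (hr : 0 ≤ r) (c : ℂ)
    (hf : ∀ z, supDist a z = r → ContinuousAt f z) :
    squareIntegral (fun z => c • f z) a r = c • squareIntegral f a r :=
  squareIntegral_clm_apply (c • ContinuousLinearMap.id ℂ (H →L[ℂ] H)) hr hf

theorem squareIntegral_smul_const {E : Type*} [NormedAddCommGroup E] [NormedSpace ℂ E]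
    [CompleteSpace E] {f : ℂ → ℂ} {a r : ℝ} (hr : 0 ≤ r) (v : E)
    (hf : ∀ z, supDist a z = r → ContinuousAt f z) :
    squareIntegral (fun z => f z • v) a r = squareIntegral f a r • v :=
  squareIntegral_clm_apply (ContinuousLinearMap.toSpanSingleton ℂ v) hr hf

/-- The Cauchy transform `(2πi)⁻¹ ∮ (u - z)⁻¹ (A - u)⁻¹ du` of the resolvent over the boundary of
a square. -/
noncomputable def cauchyTransform (A : H →ₗ.[ℂ] H) (a s : ℝ) (z : ℂ) : H →L[ℂ] H :=
  (2 * (Real.pi : ℂ) * Complex.I)⁻¹ •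
    squareIntegral (fun u => (u - z)⁻¹ • resolvent A u) a s

variable {A : H →ₗ.[ℂ] H} {a s : ℝ}

theorem continuousAt_inv_sub {z : ℂ} (hz : supDist a z < s) (u : ℂ) (hu : supDist a u = s) :
    ContinuousAt (fun u : ℂ => (u - z)⁻¹) u := by
  refine ContinuousAt.inv₀ (by fun_prop) (sub_ne_zero.2 ?_)
  rintro rfl
  exact hz.ne hu

theorem continuousAt_inv_smul_resolvent (hA : ∀ z, supDist a z = s → z ∈ resolventSet A) {z : ℂ}
    (hz : supDist a z < s) (u : ℂ) (hu : supDist a u = s) :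
    ContinuousAt (fun u => (u - z)⁻¹ • resolvent A u) u :=
  (continuousAt_inv_sub hz u hu).smul (differentiableAt_resolvent (hA u hu)).continuousAt

theorem rieszProjection_commute (hs : 0 < s) (hA : ∀ z, supDist a z = s → z ∈ resolventSet A)
    {w : ℂ} {R : H →L[ℂ] H} (hR : IsResolventAt A w R) :
    rieszProjection A a s * R = R * rieszProjection A a s := by
  have hc : ∀ z, supDist a z = s → ContinuousAt (resolvent A) z := fun z hz =>
    (differentiableAt_resolvent (hA z hz)).continuousAt
  rw [rieszProjection, smul_mul_assoc, mul_smul_comm, ← squareIntegral_const_mul hs.le R hc,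
    ← squareIntegral_mul_const hs.le R hc]
  congr 1
  exact squareIntegral_congr hs.le fun u hu => (isResolventAt_resolvent (hA u hu)).commute hR

theorem cauchyTransform_commute (hs : 0 < s) (hA : ∀ z, supDist a z = s → z ∈ resolventSet A)
    {w z : ℂ} (hz : supDist a z < s) {R : H →L[ℂ] H} (hR : IsResolventAt A w R) :
    cauchyTransform A a s z * R = R * cauchyTransform A a s z := by
  have hc := continuousAt_inv_smul_resolvent hA hz
  rw [cauchyTransform, smul_mul_assoc, mul_smul_comm, ← squareIntegral_const_mul hs.le R hc,
    ← squareIntegral_mul_const hs.le R hc]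
  congr 1
  refine squareIntegral_congr hs.le fun u hu => ?_
  rw [smul_mul_assoc, mul_smul_comm, (isResolventAt_resolvent (hA u hu)).commute hR]

/-- The Cauchy transform of the resolvent inverts `A - z` modulo the Riesz projection. -/
theorem cauchyTransform_eq (hs : 0 < s) (hA : ∀ z, supDist a z = s → z ∈ resolventSet A)
    {w z : ℂ} (hz : supDist a z < s) {R : H →L[ℂ] H} (hR : IsResolventAt A w R) :
    cauchyTransform A a s z =
      R * (1 - rieszProjection A a s + (z - w) • cauchyTransform A a s z) := by
  have hc := continuousAt_inv_smul_resolvent hA hz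
  have hc' : ∀ z, supDist a z = s → ContinuousAt (resolvent A) z := fun z hz =>
    (differentiableAt_resolvent (hA z hz)).continuousAt
  have hi := continuousAt_inv_sub hz
  have h1 : squareIntegral (fun u => (u - z)⁻¹ • resolvent A u) a s =
      squareIntegral (fun u => R * ((u - z)⁻¹ • 1 +
        (resolvent A u + (z - w) • ((u - z)⁻¹ • resolvent A u)))) a s := by
    refine squareIntegral_congr hs.le fun u hu => ?_
    have hne : u - z ≠ 0 := by
      refine sub_ne_zero.2 ?_
      rintro rfl
      exact hz.ne hu
    have e := (isResolventAt_resolvent (hA u hu)).sub_eq hR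
    rw [(isResolventAt_resolvent (hA u hu)).commute hR] at e
    -- Partial fractions split the resolvent identity into three integrals: the winding integral
    -- gives `1`, the bare resolvent gives `-P`, and the rest is the transform itself.
    have hk : (u - z)⁻¹ * (u - w) = 1 + (z - w) * (u - z)⁻¹ := by field_simp; ring
    have e2 : (u - z)⁻¹ • (resolvent A u - R) =
        (1 + (z - w) * (u - z)⁻¹) • (R * resolvent A u) := by
      rw [e, smul_smul, hk]
    simp only [mul_add, mul_smul_comm, mul_one]
    linear_combination (norm := module) e2
  have hpi : (2 * (Real.pi : ℂ) * Complex.I) ≠ 0 := Complex.two_pi_I_ne_zero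
  have hc1 : ∀ u, supDist a u = s → ContinuousAt (fun u => (u - z)⁻¹ • (1 : H →L[ℂ] H)) u :=
    fun u hu => (hi u hu).smul continuousAt_const
  have hc2 : ∀ u, supDist a u = s →
      ContinuousAt (fun u => (z - w) • (u - z)⁻¹ • resolvent A u) u :=
    fun u hu => (hc u hu).const_smul (z - w)
  have hc3 : ∀ u, supDist a u = s →
      ContinuousAt (fun u => resolvent A u + (z - w) • (u - z)⁻¹ • resolvent A u) u :=
    fun u hu => (hc' u hu).add (hc2 u hu)
  have hc4 : ∀ u, supDist a u = s → ContinuousAt (fun u => (u - z)⁻¹ • (1 : H →L[ℂ] H) +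
      (resolvent A u + (z - w) • (u - z)⁻¹ • resolvent A u)) u :=
    fun u hu => (hc1 u hu).add (hc3 u hu)
  rw [squareIntegral_const_mul hs.le R hc4,
    squareIntegral_add hs.le hc1 hc3, squareIntegral_add hs.le hc' hc2,
    squareIntegral_const_smul hs.le _ hc, squareIntegral_smul_const hs.le _ hi,
    squareIntegral_inv_sub hz] at h1
  rw [cauchyTransform, rieszProjection]
  conv_lhs => rw [h1]
  rw [← mul_smul_comm]
  congr 1
  rw [smul_add, smul_smul, inv_mul_cancel₀ hpi]
  module

variable {r : ℝ}

/-- The Riesz projection over a square whose boundary has a resolvent collar is idempotent. -/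
theorem rieszProjection_mul_self (hr : 0 < r) (hrs : r < s)
    (hA : ∀ z, r ≤ supDist a z → supDist a z ≤ s → z ∈ resolventSet A) :
    rieszProjection A a s * rieszProjection A a s = rieszProjection A a s := by
  have hs : 0 < s := hr.trans hrs
  have hA' : ∀ z, supDist a z = s → z ∈ resolventSet A := fun z hz => hA z (by linarith) hz.le
  have hAr : ∀ z, supDist a z = r → z ∈ resolventSet A := fun z hz => hA z hz.ge (by linarith)
  have h1 : squareIntegral (resolvent A) a r = squareIntegral (resolvent A) a s :=
    squareIntegral_eq_of_differentiableAt hr.le hrs.le fun z h h' =>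
      differentiableAt_resolvent (hA z h h')
  -- The transform is holomorphic inside the outer square and equals `R_u (1 - P)` on the inner one.
  -- Integrating over the inner square gives `P (1 - P) = 0` with no double integral.
  have h2 : squareIntegral (cauchyTransform A a s) a r = 0 := by
    refine squareIntegral_eq_zero hr.le fun z hz => ?_
    have h := differentiableAt_squareIntegral_inv_smul hs.le (fun u hu =>
      (differentiableAt_resolvent (hA' u hu)).continuousAt) (hz.trans_lt hrs)
    exact h.const_smul (2 * (Real.pi : ℂ) * Complex.I)⁻¹
  have h3 : squareIntegral (cauchyTransform A a s) a r =
      squareIntegral (fun u => resolvent A u * (1 - rieszProjection A a s)) a r := by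
    refine squareIntegral_congr hr.le fun u hu => ?_
    rw [cauchyTransform_eq hs hA' (hu.trans_lt hrs) (isResolventAt_resolvent (hAr u hu)),
      sub_self, zero_smul, add_zero]
  rw [h2, squareIntegral_mul_const hr.le _ fun u hu =>
    (differentiableAt_resolvent (hAr u hu)).continuousAt, h1, mul_sub, mul_one] at h3
  have h4 : squareIntegral (resolvent A) a s =
      squareIntegral (resolvent A) a s * rieszProjection A a s := sub_eq_zero.1 h3.symm
  conv_rhs => rw [rieszProjection, h4]
  rw [← smul_mul_assoc]
  rfl

/-- On an eigenvector the resolvent acts as the scalar `(μ - u)⁻¹`, so only the winding integral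
remains. -/
theorem rieszProjection_apply_of_mem_eigenspace (hs : 0 < s)
    (hA : ∀ z, supDist a z = s → z ∈ resolventSet A) {μ : ℂ} {x : H} (hx : x ∈ eigenspace A μ)
    (hμ : supDist a μ < s) : rieszProjection A a s x = x := by
  have hc' : ∀ z, supDist a z = s → ContinuousAt (resolvent A) z := fun z hz =>
    (differentiableAt_resolvent (hA z hz)).continuousAt
  have h1 : squareIntegral (resolvent A) a s x = squareIntegral (fun u => resolvent A u x) a s :=
    (squareIntegral_clm_apply (ContinuousLinearMap.apply ℂ H x) hs.le hc').symm
  have h2 : squareIntegral (fun u => resolvent A u x) a s =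
      squareIntegral (fun u => (u - μ)⁻¹ • (-x)) a s := by
    refine squareIntegral_congr hs.le fun u hu => ?_
    have hne : u - μ ≠ 0 := by
      refine sub_ne_zero.2 ?_
      rintro rfl
      exact hμ.ne hu
    have e := (isResolventAt_resolvent (hA u hu)).smul_apply_eigenvector hx
    rw [eq_inv_smul_iff₀ hne]
    linear_combination (norm := module) -e
  rw [rieszProjection, _root_.smul_apply, h1, h2,
    squareIntegral_smul_const hs.le _ (continuousAt_inv_sub hμ), squareIntegral_inv_sub hμ,
    smul_smul, neg_mul, inv_mul_cancel₀ Complex.two_pi_I_ne_zero]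
  simp

/-- For `μ` outside, the scalar `(μ - u)⁻¹` is holomorphic on the closed square. -/
theorem rieszProjection_apply_eq_zero (hs : 0 < s)
    (hA : ∀ z, supDist a z = s → z ∈ resolventSet A) {μ : ℂ} {x : H} (hx : x ∈ eigenspace A μ)
    (hμ : s < supDist a μ) : rieszProjection A a s x = 0 := by
  have hc' : ∀ z, supDist a z = s → ContinuousAt (resolvent A) z := fun z hz =>
    (differentiableAt_resolvent (hA z hz)).continuousAt
  have h1 : squareIntegral (resolvent A) a s x = squareIntegral (fun u => resolvent A u x) a s :=
    (squareIntegral_clm_apply (ContinuousLinearMap.apply ℂ H x) hs.le hc').symm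
  have hne : ∀ u, supDist a u ≤ s → μ - u ≠ 0 := by
    intro u hu
    refine sub_ne_zero.2 ?_
    rintro rfl
    exact hu.not_gt hμ
  have h2 : squareIntegral (fun u => resolvent A u x) a s =
      squareIntegral (fun u => (μ - u)⁻¹ • x) a s := by
    refine squareIntegral_congr hs.le fun u hu => ?_
    rw [eq_inv_smul_iff₀ (hne u hu.le)]
    exact (isResolventAt_resolvent (hA u hu)).smul_apply_eigenvector hx
  have h3 : squareIntegral (fun u => (μ - u)⁻¹ • x) a s = 0 :=
    squareIntegral_eq_zero hs.le fun u hu => by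
      refine DifferentiableAt.smul_const ?_ x
      exact DifferentiableAt.inv (by fun_prop) (hne u hu)
  rw [rieszProjection, _root_.smul_apply, h1, h2, h3, smul_zero]

/-- A rank one Riesz projection over a square isolates a single simple eigenvalue. -/
theorem exists_eigenvalue_of_finrank_rieszProjection (hr : 0 < r) (hrs : r < s)
    (hA : ∀ z, r ≤ supDist a z → supDist a z ≤ s → z ∈ resolventSet A)
    (h1 : Module.finrank ℂ (rieszProjection A a s).range = 1) :
    ∃ μ : ℂ, spectrum A ∩ openSquare a s = {μ} ∧
      (rieszProjection A a s).range = eigenspace A μ := by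
  have hs : 0 < s := hr.trans hrs
  have hA' : ∀ z, supDist a z = s → z ∈ resolventSet A := fun z hz => hA z (by linarith) hz.le
  have hP := rieszProjection_mul_self hr hrs hA
  set P := rieszProjection A a s with hPdef
  obtain ⟨w, hw⟩ : ∃ w, w ∈ resolventSet A :=
    ⟨a + s * Complex.I, hA' _ (by simp [supDist, abs_of_pos hs, hs.le])⟩
  have hR := isResolventAt_resolvent hw
  set R := resolvent A w
  have hPR : P * R = R * P := rieszProjection_commute hs hA' hR
  obtain ⟨v, hv0, hv⟩ := finrank_eq_one_iff'.1 h1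
  obtain ⟨v, hvr⟩ := v
  have hv0' : v ≠ 0 := fun h => hv0 (Subtype.ext h)
  have hPP : ∀ x, P (P x) = P x := fun x => congrArg (fun T : H →L[ℂ] H => T x) hP
  have hPv : P v = v := by
    obtain ⟨x, rfl⟩ := hvr
    exact hPP x
  have hspan : ∀ x, P x = x → ∃ c : ℂ, c • v = x := fun x hx => by
    obtain ⟨c, hc⟩ := hv ⟨x, ⟨x, hx⟩⟩
    exact ⟨c, congrArg Subtype.val hc⟩
  have hPRx : ∀ x, P (R x) = R (P x) := fun x => congrArg (fun T : H →L[ℂ] H => T x) hPR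
  -- `R` preserves the line `range P`, so `v` is an eigenvector of `R` with some eigenvalue `c`.
  -- Injectivity gives `c ≠ 0`, and `v` is then an eigenvector of `A` for `w + c⁻¹`.
  obtain ⟨c, hc⟩ := hspan (R v) (by rw [hPRx, hPv])
  have hc0 : c ≠ 0 := by
    rintro rfl
    rw [zero_smul] at hc
    exact hv0' (hR.apply_injective hc.symm)
  set μ : ℂ := w + c⁻¹ with hμdef
  have hvμ : v ∈ eigenspace A μ := hR.mem_eigenspace (by
    rw [hμdef, add_sub_cancel_left, ← hc, smul_smul, inv_mul_cancel₀ hc0, one_smul])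
  have hμspec : μ ∈ spectrum A := eigenvalue_mem_spectrum hvμ hv0'
  have hμs : supDist a μ < s := by
    rcases lt_trichotomy (supDist a μ) s with h | h | h
    · exact h
    · exact absurd (hA' μ h) hμspec
    · exact absurd (hPv.symm.trans (rieszProjection_apply_eq_zero hs hA' hvμ h)) hv0'
  have hrange : P.range = eigenspace A μ := by
    ext x
    constructor
    · rintro ⟨y, rfl⟩
      obtain ⟨d, hd⟩ := hspan (P y) (hPP y)
      change P y ∈ _
      rw [← hd]
      exact Submodule.smul_mem _ _ hvμ
    · intro hx
      exact ⟨x, rieszProjection_apply_of_mem_eigenspace hs hA' hx hμs⟩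
  refine ⟨μ, ?_, hrange⟩
  ext z
  simp only [Set.mem_inter_iff, Set.mem_singleton_iff, mem_openSquare_iff]
  constructor
  · rintro ⟨hzs, hz⟩
    by_contra hne
    -- The inverse of `A - z` is assembled from its two parts: the Cauchy transform on the range of
    -- `1 - P`, and the scalar `(μ - z)⁻¹` on the range of `P`.
    refine hzs (IsResolventAt.mem_resolventSet
      (R := cauchyTransform A a s z * (1 - P) + (μ - z)⁻¹ • P) ?_)
    have hne' : μ - z ≠ 0 := sub_ne_zero.2 (Ne.symm hne)
    have hT := cauchyTransform_eq hs hA' hz hR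
    have hTR := cauchyTransform_commute hs hA' hz hR
    rw [← hPdef] at hT
    set T := cauchyTransform A a s z
    have hRP : (μ - w) • (R * P) = P := by
      ext x
      exact hR.smul_apply_eigenvector (hrange ▸ ⟨x, rfl⟩ : P x ∈ eigenspace A μ)
    set X := T * (1 - P) + (μ - z)⁻¹ • P with hX
    have hidem : (1 - P) * (1 - P) = 1 - P := by
      rw [mul_sub, sub_mul, one_mul, mul_one, sub_mul, hP, one_mul]; abel
    have h2 : X = R * (1 + (z - w) • X) := by
      have e1 : T * (1 - P) = R * (1 - P + (z - w) • (T * (1 - P))) := by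
        conv_lhs => rw [hT]
        rw [mul_assoc, add_mul, hidem, smul_mul_assoc]
      have e2 : (μ - z)⁻¹ • P = R * (P + (z - w) • ((μ - z)⁻¹ • P)) := by
        conv_lhs => rw [← hRP]
        rw [mul_add, mul_smul_comm, mul_smul_comm, smul_smul, smul_smul]
        have : (μ - z)⁻¹ * (μ - w) = 1 + (z - w) * (μ - z)⁻¹ := by field_simp; ring
        rw [this, add_smul, one_smul]
      calc X = R * (1 - P + (z - w) • (T * (1 - P))) + R * (P + (z - w) • ((μ - z)⁻¹ • P)) := by
            rw [← e1, ← e2]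
        _ = R * (1 + (z - w) • X) := by
            rw [← mul_add, hX]; congr 1; module
    have hXR : X * R = R * X := by
      rw [hX, add_mul, mul_add, mul_assoc, sub_mul, hPR, smul_mul_assoc, mul_smul_comm, hPR,
        ← mul_assoc, ← hTR, mul_assoc, mul_sub R, mul_one, one_mul]
    refine hR.of_resolvent_identity h2 ?_
    rw [add_mul, one_mul, smul_mul_assoc, hXR]
    conv_lhs => rw [h2]
    rw [mul_add, mul_one, mul_smul_comm]
  · rintro rfl
    exact ⟨hμspec, hμs⟩

end Riesz

end UnboundedOp

namespace UnboundedOp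

/-! ### Constancy of rank and continuity in the perturbation parameter -/

section Stability

variable {H : Type*} [NormedAddCommGroup H] [InnerProductSpace ℂ H]

/-- `Q` is injective on `range P`: if `P x = x` and `Q x = 0`, then `‖x‖ = ‖(P - Q) x‖`, which is
smaller than `‖x‖` unless `x = 0`. Cardinal rank avoids any finiteness assumption. -/
theorem rank_range_le_of_norm_sub_lt_one {P Q : H →L[ℂ] H} (hP : P * P = P)
    (h : ‖P - Q‖ < 1) : Module.rank ℂ P.range ≤ Module.rank ℂ Q.range := by
  let f : P.range →ₗ[ℂ] Q.range :=
    (Q.toLinearMap.comp P.range.subtype).codRestrict Q.range fun x => ⟨x, rfl⟩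
  refine LinearMap.rank_le_of_injective f ((injective_iff_map_eq_zero f).2 ?_)
  rintro ⟨x, y, rfl⟩ hx
  have hQ : Q (P y) = 0 := congrArg Subtype.val hx
  have hPP : P (P y) = P y := congrArg (fun T : H →L[ℂ] H => T y) hP
  have h1 : ‖P y‖ ≤ ‖P - Q‖ * ‖P y‖ := by
    calc ‖P y‖ = ‖(P - Q) (P y)‖ := by rw [sub_apply, hPP, hQ, sub_zero]
      _ ≤ _ := (P - Q).le_opNorm _
  refine Subtype.ext ?_
  change P y = 0
  by_contra h0
  have h2 := norm_pos_iff.2 h0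
  nlinarith

/-- Idempotents at distance less than one have the same rank. -/
theorem finrank_range_eq_of_norm_sub_lt_one {P Q : H →L[ℂ] H} (hP : P * P = P) (hQ : Q * Q = Q)
    (h : ‖P - Q‖ < 1) : Module.finrank ℂ P.range = Module.finrank ℂ Q.range := by
  have := (rank_range_le_of_norm_sub_lt_one hP h).antisymm
    (rank_range_le_of_norm_sub_lt_one hQ (by rwa [norm_sub_rev]))
  rw [Module.finrank, Module.finrank, this]

/-- A continuous family of idempotents over a preconnected set has constant rank. -/
theorem finrank_range_eq_of_continuousOn {X : Type*} [TopologicalSpace X] {S : Set X}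
    (hS : IsPreconnected S) {P : X → H →L[ℂ] H} (hc : ContinuousOn P S)
    (hP : ∀ x ∈ S, P x * P x = P x) {x y : X} (hx : x ∈ S) (hy : y ∈ S) :
    Module.finrank ℂ (P x).range = Module.finrank ℂ (P y).range := by
  refine hS.constant (f := fun x => Module.finrank ℂ (P x).range) (fun x hx => ?_) hx hy
  have h := (hc x hx).sub (continuousWithinAt_const (b := P x))
  have h' := h.norm.eventually_lt_const (u := 1) (by simp)
  refine Filter.Tendsto.congr' ?_ tendsto_const_nhds
  filter_upwards [h', self_mem_nhdsWithin] with y hy hyS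
  exact (finrank_range_eq_of_norm_sub_lt_one (hP y hyS) (hP x hx) hy).symm

theorem tendsto_perturb_bound {B : H →L[ℂ] H} {δ ε : ℝ} (hε : |ε| * ‖B‖ < δ) (K : ℝ) :
    Filter.Tendsto (fun ε' : ℝ => K * (|ε' - ε| *
      (1 / (δ - |ε'| * ‖B‖) * ‖B‖ * (1 / (δ - |ε| * ‖B‖))))) (nhds ε) (nhds 0) := by
  have h : ContinuousAt (fun ε' : ℝ => K * (|ε' - ε| *
      (1 / (δ - |ε'| * ‖B‖) * ‖B‖ * (1 / (δ - |ε| * ‖B‖))))) ε := by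
    have : ContinuousAt (fun ε' : ℝ => 1 / (δ - |ε'| * ‖B‖)) ε :=
      ContinuousAt.div (by fun_prop) (by fun_prop) (by linarith)
    fun_prop
  simpa using h.tendsto

/-- A nonvanishing continuous family of idempotents onto eigenspaces has a continuous
eigenvalue. -/
theorem continuousOn_eigenvalue {X : Type*} [TopologicalSpace X] {S : Set X}
    {A : X → H →ₗ.[ℂ] H} {R P : X → H →L[ℂ] H} {μ : X → ℝ} {w : ℂ}
    (hR : ∀ x ∈ S, IsResolventAt (A x) w (R x)) (hRc : ContinuousOn R S) (hPc : ContinuousOn P S)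
    (hPP : ∀ x ∈ S, P x * P x = P x) (hP0 : ∀ x ∈ S, P x ≠ 0)
    (hP : ∀ x ∈ S, (P x).range = eigenspace (A x) (μ x)) : ContinuousOn μ S := by
  intro x hx
  obtain ⟨u, hu⟩ : ∃ u, P x u ≠ 0 := by
    by_contra! hh
    exact hP0 x hx (ContinuousLinearMap.ext hh)
  set v := P x u with hv
  have hPv : P x v = v := congrArg (fun T : H →L[ℂ] H => T u) (hPP x hx)
  -- For fixed `v` in the range of `P x`, the vector `P y v` is in the eigenspace for `μ y`. So `μ y
  -- - w` is a quotient of continuous functions wherever the denominator is nonzero, in particular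
  -- near `x`.
  have hrel : ∀ y ∈ S, (μ y - w) * ⟪v, R y (P y v)⟫_ℂ = ⟪v, P y v⟫_ℂ := by
    intro y hy
    have hm : P y v ∈ eigenspace (A y) (μ y) := hP y hy ▸ ⟨v, rfl⟩
    rw [← inner_smul_right, (hR y hy).smul_apply_eigenvector hm]
  have hPvc : ContinuousWithinAt (fun y => P y v) S x :=
    (hPc x hx).clm_apply continuousWithinAt_const
  have hN : ContinuousWithinAt (fun y => ⟪v, P y v⟫_ℂ) S x :=
    ContinuousWithinAt.inner (𝕜 := ℂ) continuousWithinAt_const hPvc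
  have hD : ContinuousWithinAt (fun y => ⟪v, R y (P y v)⟫_ℂ) S x :=
    ContinuousWithinAt.inner (𝕜 := ℂ) continuousWithinAt_const ((hRc x hx).clm_apply hPvc)
  have hD0 : ⟪v, R x (P x v)⟫_ℂ ≠ 0 := by
    intro h0
    have := hrel x hx
    rw [h0, mul_zero, hPv] at this
    exact hu (inner_self_eq_zero.1 this.symm)
  have hq : ContinuousWithinAt (fun y => (w + ⟪v, P y v⟫_ℂ / ⟪v, R y (P y v)⟫_ℂ).re) S x :=
    Complex.continuous_re.continuousAt.comp_continuousWithinAt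
      (continuousWithinAt_const.add (hN.div hD hD0))
  refine hq.congr_of_eventuallyEq_of_mem ?_ hx
  filter_upwards [hD.eventually_ne hD0, self_mem_nhdsWithin] with y hy hyS
  have h1 := hrel y hyS
  rw [← h1, mul_div_cancel_right₀ _ hy, add_sub_cancel, Complex.ofReal_re]

variable [CompleteSpace H]

/-- If the resolvent blows up at most like the inverse distance, then the Riesz projection has
range in the geometric eigenspace. -/
theorem range_rieszProjection_eq_eigenspace {A : H →ₗ.[ℂ] H} {a s : ℝ} (hs : 0 < s)
    (hA : ∀ z, 0 < supDist a z → supDist a z ≤ s →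
      z ∈ resolventSet A ∧ ‖resolvent A z‖ ≤ 1 / supDist a z) :
    (rieszProjection A a s).range = eigenspace A a := by
  have hA' : ∀ z, supDist a z = s → z ∈ resolventSet A := fun z hz =>
    (hA z (by linarith) hz.le).1
  have hda : supDist a a = 0 := by simp [supDist]
  have hc' : ∀ z, supDist a z = s → ContinuousAt (resolvent A) z := fun z hz =>
    (differentiableAt_resolvent (hA' z hz)).continuousAt
  -- This integral is, up to a constant, the nilpotent part `(A - a) P`. The integrand has norm at
  -- most `2`, so over a square of half-side `ρ` the integral is at most `16 ρ`; hence the choice `η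
  -- / 16`.
  have hN : squareIntegral (fun u => (u - a) • resolvent A u) a s = 0 := by
    rw [← norm_le_zero_iff]
    refine le_of_forall_pos_le_add fun η hη => ?_
    set ρ := min s (η / 16) with hρ
    have hρ0 : 0 < ρ := lt_min hs (by positivity)
    have hd : ∀ z, ρ ≤ supDist a z → supDist a z ≤ s →
        DifferentiableAt ℂ (fun u => (u - (a : ℂ)) • resolvent A u) z := fun z h h' =>
      (differentiableAt_id.sub_const (a : ℂ)).smul
        (differentiableAt_resolvent (hA z (hρ0.trans_le h) h').1)
    rw [← squareIntegral_eq_of_differentiableAt hρ0.le (min_le_left _ _) hd]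
    refine (norm_squareIntegral_le (C := 2) hρ0.le fun z hz => ?_).trans ?_
    · have hz0 : 0 < supDist a z := by rw [hz]; exact hρ0
      have h1 := (hA z hz0 (by rw [hz]; exact min_le_left _ _)).2
      rw [norm_smul]
      calc ‖z - a‖ * ‖resolvent A z‖ ≤ (2 * supDist a z) * (1 / supDist a z) := by
            gcongr
            exact norm_sub_le_two_mul_supDist a z
        _ = 2 := by field_simp
    · have := min_le_right s (η / 16)
      linarith
  -- Integrate `R_u = R_w + (u - w) R_w R_u` with `u - w = (u - a) + (a - w)`. The constant term and
  -- the `u - a` term vanish.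
  have key : ∀ w ∈ resolventSet A, squareIntegral (resolvent A) a s =
      (a - w) • (resolvent A w * squareIntegral (resolvent A) a s) := by
    intro w hw
    have hR := isResolventAt_resolvent hw
    set R := resolvent A w
    have c1 : ∀ u, supDist a u = s → ContinuousAt (fun u => (u - (a : ℂ)) • resolvent A u) u :=
      fun u hu => (continuousAt_id.sub continuousAt_const).smul (hc' u hu)
    have c2 : ∀ u, supDist a u = s → ContinuousAt (fun u => (a - w) • resolvent A u) u :=
      fun u hu => (hc' u hu).const_smul (a - w)
    have c3 : ∀ u, supDist a u = s → ContinuousAt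
        (fun u => (u - (a : ℂ)) • resolvent A u + (a - w) • resolvent A u) u :=
      fun u hu => (c1 u hu).add (c2 u hu)
    have h1 : squareIntegral (resolvent A) a s = squareIntegral (fun u => R +
        R * ((u - (a : ℂ)) • resolvent A u + (a - w) • resolvent A u)) a s := by
      refine squareIntegral_congr hs.le fun u hu => ?_
      have hRu := isResolventAt_resolvent (hA' u hu)
      have e := hRu.sub_eq hR
      rw [hRu.commute hR] at e
      rw [mul_add, mul_smul_comm, mul_smul_comm]
      linear_combination (norm := module) e
    have c4 : ∀ u, supDist a u = s → ContinuousAt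
        (fun u => R * ((u - (a : ℂ)) • resolvent A u + (a - w) • resolvent A u)) u :=
      fun u hu => continuousAt_const.mul (c3 u hu)
    rw [squareIntegral_add hs.le (fun _ _ => continuousAt_const) c4, squareIntegral_const_mul hs.le R c3,
      squareIntegral_add hs.le c1 c2, hN, squareIntegral_const_smul hs.le _ hc', zero_add,
      squareIntegral_eq_zero hs.le (fun _ _ => differentiableAt_const _), zero_add,
      mul_smul_comm] at h1
    exact h1
  ext x
  constructor
  · rintro ⟨y, rfl⟩
    have hw : (a + s * Complex.I : ℂ) ∈ resolventSet A :=
      hA' _ (by simp [supDist, abs_of_pos hs, hs.le])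
    refine (isResolventAt_resolvent hw).mem_eigenspace ?_
    have h := congrArg (fun T : H →L[ℂ] H => T y) (key _ hw)
    have h' : squareIntegral (resolvent A) a s y = (a - (a + s * Complex.I : ℂ)) •
      resolvent A (a + s * Complex.I) (squareIntegral (resolvent A) a s y) := h
    change _ • resolvent A _ ((-(2 * (Real.pi : ℂ) * Complex.I)⁻¹) •
      squareIntegral (resolvent A) a s y) = (-(2 * (Real.pi : ℂ) * Complex.I)⁻¹) •
      squareIntegral (resolvent A) a s y
    rw [map_smul, smul_comm, ← h']
  · intro hx
    exact ⟨x, rieszProjection_apply_of_mem_eigenspace hs hA' hx (by rwa [hda])⟩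

variable {A : H →ₗ.[ℂ] H} {B : H →L[ℂ] H} {a δ : ℝ}

theorem norm_resolvent_perturb_sub_le {ε ε' C C' : ℝ} {z : ℂ}
    (h : z ∈ resolventSet (perturb A B ε)) (h' : z ∈ resolventSet (perturb A B ε'))
    (hC : ‖resolvent (perturb A B ε) z‖ ≤ C) (hC' : ‖resolvent (perturb A B ε') z‖ ≤ C') :
    ‖resolvent (perturb A B ε) z - resolvent (perturb A B ε') z‖ ≤
      |ε - ε'| * (C * ‖B‖ * C') := by
  have hC0 : 0 ≤ C := (norm_nonneg _).trans hC
  rw [(isResolventAt_resolvent h).perturb_sub_eq (isResolventAt_resolvent h'), norm_smul,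
    ← Complex.ofReal_sub, Complex.norm_real, Real.norm_eq_abs, abs_sub_comm]
  gcongr
  refine (norm_mul_le _ _).trans ?_
  gcongr
  refine (norm_mul_le _ _).trans ?_
  gcongr

theorem continuousOn_resolvent_perturb {z : ℂ}
    (h : ∀ ε : ℝ, |ε| * ‖B‖ < δ → z ∈ resolventSet (perturb A B ε) ∧
      ‖resolvent (perturb A B ε) z‖ ≤ 1 / (δ - |ε| * ‖B‖)) :
    ContinuousOn (fun ε : ℝ => resolvent (perturb A B ε) z) {ε | |ε| * ‖B‖ < δ} := by
  intro ε hε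
  refine tendsto_iff_norm_sub_tendsto_zero.2 ?_
  refine squeeze_zero' (Filter.Eventually.of_forall fun _ => norm_nonneg _) ?_
    ((tendsto_perturb_bound hε 1).mono_left nhdsWithin_le_nhds)
  filter_upwards [self_mem_nhdsWithin] with ε' hε'
  rw [one_mul]
  exact norm_resolvent_perturb_sub_le (h ε' hε').1 (h ε hε).1 (h ε' hε').2 (h ε hε).2

theorem continuousOn_rieszProjection_perturb (hδ : 0 < δ)
    (h : ∀ ε : ℝ, |ε| * ‖B‖ < δ → ∀ z, supDist a z = δ → z ∈ resolventSet (perturb A B ε) ∧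
      ‖resolvent (perturb A B ε) z‖ ≤ 1 / (δ - |ε| * ‖B‖)) :
    ContinuousOn (fun ε : ℝ => rieszProjection (perturb A B ε) a δ) {ε | |ε| * ‖B‖ < δ} := by
  intro ε hε
  refine tendsto_iff_norm_sub_tendsto_zero.2 ?_
  refine squeeze_zero' (Filter.Eventually.of_forall fun _ => norm_nonneg _) ?_
    ((tendsto_perturb_bound hε (‖(-(2 * (Real.pi : ℂ) * Complex.I)⁻¹)‖ * (8 * δ))).mono_left
      nhdsWithin_le_nhds)
  filter_upwards [self_mem_nhdsWithin] with ε' hε'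
  have hc : ∀ ε : ℝ, |ε| * ‖B‖ < δ → ∀ z, supDist a z = δ →
      ContinuousAt (resolvent (perturb A B ε)) z := fun ε hε z hz =>
    (differentiableAt_resolvent (h ε hε z hz).1).continuousAt
  rw [rieszProjection, rieszProjection, ← smul_sub, norm_smul,
    ← squareIntegral_sub hδ.le (hc ε' hε') (hc ε hε)]
  refine le_trans (mul_le_mul_of_nonneg_left (norm_squareIntegral_le hδ.le fun z hz => ?_)
    (norm_nonneg _)) (mul_assoc _ _ _).ge
  exact norm_resolvent_perturb_sub_le (h ε' hε' z hz).1 (h ε hε z hz).1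
    (h ε' hε' z hz).2 (h ε hε z hz).2

end Stability

end UnboundedOp

/-! ### Spectral gaps -/

section GapLemmas

theorem two_mul_le_abs_sub_of_gap {lam : ℕ → ℝ} (hmono : StrictMono lam) {δ : ℝ}
    (hgap : ∀ j, 2 * δ ≤ lam (j + 1) - lam j) {j l : ℕ} (h : j ≠ l) :
    2 * δ ≤ |lam j - lam l| := by
  rcases lt_or_gt_of_ne h with h | h
  · have h1 := hmono.monotone (Nat.succ_le_of_lt h)
    have h2 := hgap j
    rw [abs_sub_comm]
    refine le_trans ?_ (le_abs_self _)
    simp only [Nat.succ_eq_add_one] at h1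
    linarith
  · have h1 := hmono.monotone (Nat.succ_le_of_lt h)
    have h2 := hgap l
    refine le_trans ?_ (le_abs_self _)
    simp only [Nat.succ_eq_add_one] at h1
    linarith

/-- Every other eigenvalue is at least `2 δ` from the centre, hence at least `δ` from any point of
the closed square. -/
theorem UnboundedOp.supDist_le_norm_sub_of_gap {lam : ℕ → ℝ} {δ : ℝ}
    (hgap : ∀ j l, j ≠ l → 2 * δ ≤ |lam j - lam l|) {l : ℕ} {z : ℂ}
    (hz : supDist (lam l) z ≤ δ) (j : ℕ) : supDist (lam l) z ≤ ‖(lam j : ℂ) - z‖ := by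
  rcases eq_or_ne j l with rfl | hne
  · rw [norm_sub_rev]
    exact supDist_le_norm_sub _ _
  · have h1 := hgap j l hne
    have h2 : |z.re - lam l| ≤ supDist (lam l) z := le_max_left _ _
    have h3 := abs_sub_le (lam j) z.re (lam l)
    have h4 := Complex.abs_re_le_norm ((lam j : ℂ) - z)
    rw [Complex.sub_re, Complex.ofReal_re] at h4
    linarith

end GapLemmas

/-! ### The main theorem -/

theorem theorem1p2 {H : Type*} [NormedAddCommGroup H] [InnerProductSpace ℂ H] [CompleteSpace H]
    (H₀ : H →ₗ.[ℂ] H) (H₁ J : H →L[ℂ] H)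
    -- `H₀` is self-adjoint and bounded below
    (hsa : IsSelfAdjoint H₀)
    (hbdd : ∃ c : ℝ, ∀ x : H₀.domain, c * ‖(x : H)‖ ^ 2 ≤ (⟪(x : H), H₀ x⟫_ℂ).re)
    -- `J` is a unitary involution preserving the domain, with `J H₀ = H₀* J`, `J H₁ = H₁* J`
    (hJunitary : J ∈ unitary (H →L[ℂ] H))
    (hJinvol : J * J = 1)
    (hJdom : ∀ x ∈ H₀.domain, J x ∈ H₀.domain)
    (hJH₀ : UnboundedOp.IntertwinesAdjoint J H₀)
    (hJH₁ : J * H₁ = ContinuousLinearMap.adjoint H₁ * J)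
    -- the spectrum of `H₀` is an increasing sequence of simple eigenvalues with uniform gap
    (lam : ℕ → ℝ) (hmono : StrictMono lam)
    (hspec : UnboundedOp.spectrum H₀ = Set.range fun j => (lam j : ℂ))
    (hsimple : ∀ j, Module.finrank ℂ (UnboundedOp.eigenspace H₀ (lam j)) = 1)
    (δ : ℝ) (hδ : δ = ⨅ j : ℕ, (lam (j + 1) - lam j) / 2) (hδpos : 0 < δ) :
    -- the spectrum of `H₀ + ε H₁` is real
    (∀ ε : ℝ, |ε| * ‖H₁‖ < δ →
      ∀ z ∈ UnboundedOp.spectrum (UnboundedOp.perturb H₀ H₁ ε), z.im = 0) ∧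
    -- off the squares, the resolvent exists, with its Neumann series and bound
    (∀ ε : ℝ, |ε| * ‖H₁‖ < δ → ∀ z : ℂ, (∀ l, z ∉ UnboundedOp.openSquare (lam l) δ) →
      z ∈ UnboundedOp.resolventSet (UnboundedOp.perturb H₀ H₁ ε) ∧
      HasSum (fun k : ℕ => UnboundedOp.resolvent H₀ z *
          (-((ε : ℂ) • (H₁ * UnboundedOp.resolvent H₀ z))) ^ k)
        (UnboundedOp.resolvent (UnboundedOp.perturb H₀ H₁ ε) z) ∧
      ‖UnboundedOp.resolvent (UnboundedOp.perturb H₀ H₁ ε) z‖ ≤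
        1 / (Metric.infDist z (UnboundedOp.spectrum H₀) - |ε| * ‖H₁‖)) ∧
    -- each `lam l` continues to exactly one eigenvalue `Λ l ε`, which is real and simple
    ∃ Λ : ℕ → ℝ → ℝ,
      (∀ l, Λ l 0 = lam l) ∧
      (∀ l, ContinuousOn (Λ l) {ε : ℝ | |ε| * ‖H₁‖ < δ}) ∧
      ∀ ε : ℝ, |ε| * ‖H₁‖ < δ →
        (UnboundedOp.spectrum (UnboundedOp.perturb H₀ H₁ ε) =
          Set.range fun l => (Λ l ε : ℂ)) ∧
        ∀ l,
          UnboundedOp.spectrum (UnboundedOp.perturb H₀ H₁ ε) ∩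
              UnboundedOp.openSquare (lam l) δ = {(Λ l ε : ℂ)} ∧
          Module.finrank ℂ (UnboundedOp.eigenspace (UnboundedOp.perturb H₀ H₁ ε) (Λ l ε)) = 1 ∧
          UnboundedOp.rieszProjection (UnboundedOp.perturb H₀ H₁ ε) (lam l) δ *
              UnboundedOp.rieszProjection (UnboundedOp.perturb H₀ H₁ ε) (lam l) δ =
            UnboundedOp.rieszProjection (UnboundedOp.perturb H₀ H₁ ε) (lam l) δ ∧
          (UnboundedOp.rieszProjection (UnboundedOp.perturb H₀ H₁ ε) (lam l) δ).range =
            UnboundedOp.eigenspace (UnboundedOp.perturb H₀ H₁ ε) (Λ l ε) := by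
  have hgap1 : ∀ j, 2 * δ ≤ lam (j + 1) - lam j := by
    intro j
    have hb : BddBelow (Set.range fun j : ℕ => (lam (j + 1) - lam j) / 2) := by
      refine ⟨0, ?_⟩
      rintro _ ⟨i, rfl⟩
      have := hmono (Nat.lt_succ_self i)
      simp only [Nat.succ_eq_add_one] at this
      change 0 ≤ (lam (i + 1) - lam i) / 2
      linarith
    have := ciInf_le hb j
    rw [← hδ] at this
    linarith
  have hgap : ∀ j l, j ≠ l → 2 * δ ≤ |lam j - lam l| := fun j l h =>
    two_mul_le_abs_sub_of_gap hmono hgap1 h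
  have hres : ∀ (z : ℂ) (d : ℝ), 0 < d → (∀ j, d ≤ ‖(lam j : ℂ) - z‖) →
      z ∈ UnboundedOp.resolventSet H₀ ∧ ‖UnboundedOp.resolvent H₀ z‖ ≤ 1 / d := by
    intro z d hd h
    have hz : z ∈ UnboundedOp.resolventSet H₀ := by
      by_contra hz
      have hz' : z ∈ UnboundedOp.spectrum H₀ := hz
      rw [hspec] at hz'
      obtain ⟨j, rfl⟩ := hz'
      have := h j
      rw [sub_self, norm_zero] at this
      linarith
    refine ⟨hz, UnboundedOp.norm_resolvent_le_of_isSelfAdjoint hsa hz hd fun w hw => ?_⟩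
    rw [hspec] at hw
    obtain ⟨j, rfl⟩ := hw
    exact h j
  have hpert : ∀ (ε : ℝ) (z : ℂ) (d : ℝ), |ε| * ‖H₁‖ < d → (∀ j, d ≤ ‖(lam j : ℂ) - z‖) →
      ‖(ε : ℂ) • (H₁ * UnboundedOp.resolvent H₀ z)‖ < 1 ∧ z ∈ UnboundedOp.resolventSet (UnboundedOp.perturb H₀ H₁ ε) ∧
      ‖UnboundedOp.resolvent (UnboundedOp.perturb H₀ H₁ ε) z‖ ≤ 1 / (d - |ε| * ‖H₁‖) := by
    intro ε z d hd h
    have hd0 : 0 < d := lt_of_le_of_lt (by positivity) hd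
    obtain ⟨h1, h2⟩ := hres z d hd0 h
    have h3 := UnboundedOp.norm_resolvent_perturb_le (B := H₁) (ε := (ε : ℂ)) h1
      (by rwa [Complex.norm_real, Real.norm_eq_abs]) h2
    rwa [Complex.norm_real, Real.norm_eq_abs] at h3
  have hout : ∀ z : ℂ, (∀ l, z ∉ UnboundedOp.openSquare (lam l) δ) → ∀ j, δ ≤ ‖(lam j : ℂ) - z‖ := by
    intro z hz j
    have := hz j
    rw [UnboundedOp.mem_openSquare_iff, not_lt] at this
    rw [norm_sub_rev]
    exact this.trans (UnboundedOp.supDist_le_norm_sub _ _)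
  have hann : ∀ (ε : ℝ) (l : ℕ) (z : ℂ), |ε| * ‖H₁‖ < UnboundedOp.supDist (lam l) z →
      UnboundedOp.supDist (lam l) z ≤ δ → z ∈ UnboundedOp.resolventSet (UnboundedOp.perturb H₀ H₁ ε) ∧
      ‖UnboundedOp.resolvent (UnboundedOp.perturb H₀ H₁ ε) z‖ ≤ 1 / (UnboundedOp.supDist (lam l) z - |ε| * ‖H₁‖) :=
    fun ε l z h h' => (hpert ε z _ h (UnboundedOp.supDist_le_norm_sub_of_gap hgap h')).2
  have hbd : ∀ l, ∀ ε : ℝ, |ε| * ‖H₁‖ < δ → ∀ z, UnboundedOp.supDist (lam l) z = δ →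
      z ∈ UnboundedOp.resolventSet (UnboundedOp.perturb H₀ H₁ ε) ∧
      ‖UnboundedOp.resolvent (UnboundedOp.perturb H₀ H₁ ε) z‖ ≤ 1 / (δ - |ε| * ‖H₁‖) := by
    intro l ε hε z hz
    have := hann ε l z (by rwa [hz]) hz.le
    rwa [hz] at this
  have hcollar : ∀ ε : ℝ, |ε| * ‖H₁‖ < δ → ∃ r, 0 < r ∧ r < δ ∧ ∀ l z, r ≤ UnboundedOp.supDist (lam l) z →
      UnboundedOp.supDist (lam l) z ≤ δ → z ∈ UnboundedOp.resolventSet (UnboundedOp.perturb H₀ H₁ ε) := by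
    intro ε hε
    have h0 : 0 ≤ |ε| * ‖H₁‖ := by positivity
    -- The midpoint is positive even when `ε = 0` and lies strictly above `|ε| ‖H₁‖`.
    exact ⟨(|ε| * ‖H₁‖ + δ) / 2, by linarith, by linarith,
      fun l z h h' => (hann ε l z (by linarith) h').1⟩
  have hproj : ∀ ε : ℝ, |ε| * ‖H₁‖ < δ → ∀ l,
      UnboundedOp.rieszProjection (UnboundedOp.perturb H₀ H₁ ε) (lam l) δ * UnboundedOp.rieszProjection (UnboundedOp.perturb H₀ H₁ ε) (lam l) δ =
        UnboundedOp.rieszProjection (UnboundedOp.perturb H₀ H₁ ε) (lam l) δ := by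
    intro ε hε l
    obtain ⟨r, h1, h2, h3⟩ := hcollar ε hε
    exact UnboundedOp.rieszProjection_mul_self h1 h2 (h3 l)
  have hcont := fun l => UnboundedOp.continuousOn_rieszProjection_perturb hδpos (hbd l)
  have hconn : IsPreconnected {ε : ℝ | |ε| * ‖H₁‖ < δ} := by
    have : {ε : ℝ | |ε| * ‖H₁‖ < δ} = {ε : ℝ | ‖ε • ‖H₁‖‖ < δ} := by
      ext ε; simp
    -- A preimage of a ball under a linear map is convex, and this description also covers `H₁ = 0`.
    have hball : {ε : ℝ | |ε| * ‖H₁‖ < δ} =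
        (LinearMap.toSpanSingleton ℝ ℝ ‖H₁‖) ⁻¹' Metric.ball 0 δ := by
      rw [this]; ext ε; simp
    rw [hball]
    exact ((convex_ball (0 : ℝ) δ).linear_preimage _).isPreconnected
  have h0mem : |(0 : ℝ)| * ‖H₁‖ < δ := by simpa using hδpos
  have hrank : ∀ ε : ℝ, |ε| * ‖H₁‖ < δ → ∀ l,
      Module.finrank ℂ (UnboundedOp.rieszProjection (UnboundedOp.perturb H₀ H₁ ε) (lam l) δ).range = 1 := by
    intro ε hε l
    rw [UnboundedOp.finrank_range_eq_of_continuousOn hconn (hcont l) (fun ε hε => hproj ε hε l) hε h0mem,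
      Complex.ofReal_zero, UnboundedOp.perturb_zero, UnboundedOp.range_rieszProjection_eq_eigenspace hδpos
        fun z hz hz' => hres z _ hz (UnboundedOp.supDist_le_norm_sub_of_gap hgap hz')]
    exact hsimple l
  -- The bound on `ε` sits under the existential so that `choose` yields a function on all of `ℝ`,
  -- with an arbitrary value where the bound fails.
  have hex : ∀ (l : ℕ) (ε : ℝ), ∃ x : ℝ, |ε| * ‖H₁‖ < δ →
      UnboundedOp.spectrum (UnboundedOp.perturb H₀ H₁ ε) ∩ UnboundedOp.openSquare (lam l) δ = {(x : ℂ)} ∧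
      (UnboundedOp.rieszProjection (UnboundedOp.perturb H₀ H₁ ε) (lam l) δ).range = UnboundedOp.eigenspace (UnboundedOp.perturb H₀ H₁ ε) x := by
    intro l ε
    by_cases hε : |ε| * ‖H₁‖ < δ
    · obtain ⟨r, h1, h2, h3⟩ := hcollar ε hε
      obtain ⟨μ, hμ, hμr⟩ := UnboundedOp.exists_eigenvalue_of_finrank_rieszProjection h1 h2 (h3 l)
        (hrank ε hε l)
      have hmem : μ ∈ UnboundedOp.spectrum (UnboundedOp.perturb H₀ H₁ ε) ∩ UnboundedOp.openSquare (lam l) δ := by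
        rw [hμ]; exact Set.mem_singleton μ
      -- Spectrum and square are both invariant under conjugation, so uniqueness of `μ` makes it
      -- real.
      have hconj : starRingEnd ℂ μ ∈ UnboundedOp.spectrum (UnboundedOp.perturb H₀ H₁ ε) ∩ UnboundedOp.openSquare (lam l) δ := by
        refine ⟨fun h => hmem.1 ?_, ?_⟩
        · have := UnboundedOp.conj_mem_resolventSet_perturb hsa hJinvol hJH₀ hJH₁ h
          rwa [Complex.conj_conj] at this
        · have := hmem.2
          simpa [UnboundedOp.openSquare] using this
      rw [hμ, Set.mem_singleton_iff, Complex.conj_eq_iff_re] at hconj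
      refine ⟨μ.re, fun _ => ?_⟩
      rw [hconj]
      exact ⟨hμ, hμr⟩
    · exact ⟨0, fun h => absurd h hε⟩
  choose Λ hΛ using hex
  have hΛmem : ∀ ε : ℝ, |ε| * ‖H₁‖ < δ → ∀ l,
      (Λ l ε : ℂ) ∈ UnboundedOp.spectrum (UnboundedOp.perturb H₀ H₁ ε) ∩ UnboundedOp.openSquare (lam l) δ := by
    intro ε hε l
    rw [(hΛ l ε hε).1]
    exact Set.mem_singleton _
  have hspecΛ : ∀ ε : ℝ, |ε| * ‖H₁‖ < δ →
      UnboundedOp.spectrum (UnboundedOp.perturb H₀ H₁ ε) = Set.range fun l => (Λ l ε : ℂ) := by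
    intro ε hε
    ext z
    constructor
    · intro hz
      obtain ⟨l, hl⟩ : ∃ l, z ∈ UnboundedOp.openSquare (lam l) δ := by
        by_contra! hn
        exact hz (hpert ε z δ hε (hout z hn)).2.1
      have hzl : z ∈ UnboundedOp.spectrum (UnboundedOp.perturb H₀ H₁ ε) ∩ UnboundedOp.openSquare (lam l) δ := ⟨hz, hl⟩
      rw [(hΛ l ε hε).1] at hzl
      exact ⟨l, hzl.symm⟩
    · rintro ⟨l, rfl⟩
      exact (hΛmem ε hε l).1
  refine ⟨?_, ?_, Λ, ?_, ?_, ?_⟩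
  · intro ε hε z hz
    rw [hspecΛ ε hε] at hz
    obtain ⟨l, rfl⟩ := hz
    exact Complex.ofReal_im _
  · intro ε hε z hz
    have hne : (UnboundedOp.spectrum H₀).Nonempty := by
      rw [hspec]; exact Set.range_nonempty _
    have hle : ∀ j, Metric.infDist z (UnboundedOp.spectrum H₀) ≤ ‖(lam j : ℂ) - z‖ := by
      intro j
      rw [← dist_eq_norm, dist_comm]
      exact Metric.infDist_le_dist_of_mem (by rw [hspec]; exact ⟨j, rfl⟩)
    have hδd : δ ≤ Metric.infDist z (UnboundedOp.spectrum H₀) := by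
      refine (Metric.le_infDist hne).2 fun w hw => ?_
      rw [hspec] at hw
      obtain ⟨j, rfl⟩ := hw
      rw [dist_comm, dist_eq_norm]
      exact hout z hz j
    -- Taking `d` to be the full distance to the spectrum, not just `δ`, gives the stated bound.
    obtain ⟨h1, h2, h3⟩ := hpert ε z _ (hε.trans_le hδd) hle
    exact ⟨h2, (UnboundedOp.isResolventAt_resolvent (hres z δ hδpos (hout z hz)).1).hasSum_perturb h1, h3⟩
  · intro l
    have h := (hΛ l 0 h0mem).1
    rw [Complex.ofReal_zero, UnboundedOp.perturb_zero] at h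
    have hl : (lam l : ℂ) ∈ UnboundedOp.spectrum H₀ ∩ UnboundedOp.openSquare (lam l) δ := by
      refine ⟨by rw [hspec]; exact ⟨l, rfl⟩, ?_⟩
      simp [UnboundedOp.openSquare, hδpos]
    rw [h, Set.mem_singleton_iff] at hl
    exact_mod_cast hl.symm
  · intro l
    -- The midpoint of the top edge is a resolvent point for all admissible `ε` at once.
    have hw : UnboundedOp.supDist (lam l) (lam l + δ * Complex.I) = δ := by
      simp [UnboundedOp.supDist, abs_of_pos hδpos, hδpos.le]
    refine UnboundedOp.continuousOn_eigenvalue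
      (fun ε hε => UnboundedOp.isResolventAt_resolvent (hbd l ε hε _ hw).1)
      (UnboundedOp.continuousOn_resolvent_perturb fun ε hε => hbd l ε hε _ hw) (hcont l)
      (fun ε hε => hproj ε hε l) (fun ε hε h => ?_) (fun ε hε => (hΛ l ε hε).2)
    have h1 := hrank ε hε l
    rw [h, show ((0 : H →L[ℂ] H) : H →ₗ[ℂ] H) = 0 from rfl, LinearMap.range_zero,
      finrank_bot] at h1
    exact zero_ne_one h1
  · intro ε hε
    refine ⟨hspecΛ ε hε, fun l => ⟨(hΛ l ε hε).1, ?_, hproj ε hε l, (hΛ l ε hε).2⟩⟩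
    rw [← (hΛ l ε hε).2]
    exact hrank ε hε l
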